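/- Let $n \ge 1$, let $B = \operatorname{diag}(b_1,\dots,b_n)$ with $b_1,\dots,b_n \in \mathbb{C}\setminus\{0\}$, let $Q \in L^1([0,1];\mathbb{C}^{n\times n})$, and let $C, D \in \mathbb{C}^{n\times n}$ satisfy $\operatorname{rank}\begin{pmatrix} C & D\end{pmatrix} = n$. Let $\mathfrak{H} = L^2([0,1];\mathbb{C}^n)$, and let $L_{C,D}(Q)$ be the operator in $\mathfrak{H}$ given by $$L_{C,D}(Q)\,y = -iB^{-1}y' + Q(x)y$$ on the domain of all $y \in W^{1,1}([0,1];\mathbb{C}^n)$ (that is, $y$ absolutely continuous on $[0,1]$) such that $-iB^{-1}y' + Qy \in \mathfrak{H}$ and $Cy(0) + Dy(1) = 0$. Its resolvent set $\rho(L_{C,D}(Q))$ is the set of all $\lambda \in \mathbb{C}$ for which $L_{C,D}(Q) - \lambda$ is a bijection of the domain onto $\mathfrak{H}$ with bounded inverse. For a compact operator $T$ on $\mathfrak{H}$ let $s_1(T) \ge s_2(T) \ge \dots$ be its singular values, i.e. the eigenvalues of $(T^*T)^{1/2}$ in decreasing order, counted with multiplicity. Let $\mathcal{S}_1(\mathfrak{H})$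 be the set of compact $T$ with $s_k(T) = O(1/k)$ as $k \to \infty$, and $\mathfrak{S}_1(\mathfrak{H})$ the set of trace class operators, i.e. of compact $T$ with $\sum_k s_k(T) < \infty$. Suppose that $\rho(L_{C,D}(Q)) \neq \varnothing$. Then for every $\lambda \in \rho(L_{C,D}(Q))$ $$(L_{C,D}(Q) - \lambda)^{-1} \in \mathcal{S}_1(\mathfrak{H}) \setminus \mathfrak{S}_1(\mathfrak{H}).$$ Moreover, the sequence of singular values of $(L_{C,D}(Q)-\lambda)^{-1}$ can be decomposed into the union of $n$ disjoint non-increasing subsequences $\{s_{j,k}\}_{k\in\mathbb{N}}$, $j \in \{1,\dots,n\}$, satisfying $$s_{j,k} = \frac{|b_j| + o(1)}{\pi k} \qquad \text{as } k \to \infty.$$ -/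

import Mathlib

open MeasureTheory Filter Topology

namespace DiracBVP

noncomputable section

/-! ### Resolvents of unbounded operators, singular values, operator ideals -/

section Operators

variable {H : Type*} [NormedAddCommGroup H] [InnerProductSpace ℂ H]

/-- The bounded operator `R` is a two-sided inverse of `T - z : dom T → H`. -/
def IsResolventAt (T : H →ₗ.[ℂ] H) (z : ℂ) (R : H →L[ℂ] H) : Prop :=
  (∀ f : H, ∃ hf : R f ∈ T.domain, T ⟨R f, hf⟩ - z • R f = f) ∧
    ∀ u : T.domain, R (T u - z • (u : H)) = u

/-- The resolvent set of an unbounded operator: those `z` for which `T - z` is a bijection from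
`dom T` onto `H` with bounded inverse. -/
def resolventSet (T : H →ₗ.[ℂ] H) : Set ℂ :=
  {z | ∃ R : H →L[ℂ] H, IsResolventAt T z R}

open Classical in
/-- The resolvent `(T - z)⁻¹` (zero by convention off the resolvent set). -/
def resolvent (T : H →ₗ.[ℂ] H) (z : ℂ) : H →L[ℂ] H :=
  if h : ∃ R : H →L[ℂ] H, IsResolventAt T z R then h.choose else 0

theorem isResolventAt_resolvent {T : H →ₗ.[ℂ] H} {z : ℂ} (hz : z ∈ resolventSet T) :
    IsResolventAt T z (resolvent T z) := by
  have h : ∃ R : H →L[ℂ] H, IsResolventAt T z R := hz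
  rw [resolvent, dif_pos h]
  exact h.choose_spec

theorem IsResolventAt.unique {T : H →ₗ.[ℂ] H} {z : ℂ} {R R' : H →L[ℂ] H}
    (h : IsResolventAt T z R) (h' : IsResolventAt T z R') : R = R' := by
  ext f
  obtain ⟨hf, e⟩ := h.1 f
  have := h'.2 ⟨R f, hf⟩
  rw [e] at this
  exact this.symm

variable [CompleteSpace H]

/-- The span of all eigenvectors of `(T* T)^{1/2}` for eigenvalues `≥ t`. As eigenspaces are
independent, its dimension is the number of such eigenvalues, counted with multiplicity. -/
def absEigenspan (T : H →L[ℂ] H) (t : ℝ) : Submodule ℂ H :=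
  ⨆ r : ℝ, ⨆ _ : t ≤ r,
    Module.End.eigenspace ((CFC.abs T : H →L[ℂ] H) : H →ₗ[ℂ] H) (r : ℂ)

/-- The singular values of a compact operator `T`, indexed from `0`: `singularValue T k` is the
`(k+1)`-st largest eigenvalue of `(T* T)^{1/2}` counted with multiplicity, that is, the largest
`t > 0` such that at least `k + 1` eigenvalues are `≥ t` (and `0` if there is no such `t`). -/
def singularValue (T : H →L[ℂ] H) (k : ℕ) : ℝ :=
  sSup {t : ℝ | 0 < t ∧ (k : Cardinal) < Module.rank ℂ (absEigenspan T t)}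

/-- The Schatten-von Neumann ideal of exponent `p`, `0 < p < ∞`. For `p = 1` these are the
trace class operators. -/
def IsSchatten (p : ℝ) (T : H →L[ℂ] H) : Prop :=
  IsCompactOperator T ∧ Summable fun k : ℕ => singularValue T k ^ p

/-- The weak ideal of exponent `p`: compact operators whose `j`-th singular value, `j ≥ 1`, is
`O(j^(-1/p))`. -/
def IsWeakSchatten (p : ℝ) (T : H →L[ℂ] H) : Prop :=
  IsCompactOperator T ∧
    (fun k : ℕ => singularValue T k) =O[atTop] fun k : ℕ => ((k : ℝ) + 1) ^ (-1 / p)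

end Operators

/-! ### The boundary value problem -/

/-- Lebesgue measure on `[0, 1]`. -/
abbrev unitVolume : Measure ℝ := volume.restrict (Set.Icc (0 : ℝ) 1)

/-- The Hilbert space `L²([0, 1]; ℂⁿ)`. -/
abbrev L2 (n : ℕ) : Type := Lp (EuclideanSpace ℂ (Fin n)) 2 unitVolume

/-- `y ∈ W^{1,1}([0, 1]; ℂⁿ)` with derivative `y'`: `y` is absolutely continuous on `[0, 1]`, and
its almost everywhere derivative `y'` is integrable. -/
structure IsW11 {n : ℕ} (y y' : ℝ → EuclideanSpace ℂ (Fin n)) : Prop where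
  absCont : AbsolutelyContinuousOnInterval y 0 1
  integrable : Integrable y' unitVolume
  hasDeriv : ∀ᵐ x ∂unitVolume, HasDerivAt y (y' x) x

/-- The differential expression `-i B⁻¹ y' + Q(x) y` with `B = diag(b₁, …, bₙ)`. -/
def diffExpr {n : ℕ} (b : Fin n → ℂ) (Q : ℝ → Matrix (Fin n) (Fin n) ℂ)
    (y y' : ℝ → EuclideanSpace ℂ (Fin n)) (x : ℝ) : EuclideanSpace ℂ (Fin n) :=
  WithLp.toLp 2
    ((-Complex.I) • (Matrix.diagonal b)⁻¹.mulVec (y' x).ofLp + (Q x).mulVec (y x).ofLp)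

/-- The graph of the operator `L_{C,D}(Q)`: pairs `(f, g)` in `L² × L²` such that `f` is (the class
of) some `y ∈ W^{1,1}` with `C y(0) + D y(1) = 0` and `g = -i B⁻¹ y' + Q y`. -/
def opGraph {n : ℕ} (b : Fin n → ℂ) (C D : Matrix (Fin n) (Fin n) ℂ)
    (Q : ℝ → Matrix (Fin n) (Fin n) ℂ) : Submodule ℂ (L2 n × L2 n) where
  carrier := {p | ∃ y y' : ℝ → EuclideanSpace ℂ (Fin n), IsW11 y y' ∧
    C.mulVec (y 0).ofLp + D.mulVec (y 1).ofLp = 0 ∧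
    p.1 =ᵐ[unitVolume] y ∧ p.2 =ᵐ[unitVolume] diffExpr b Q y y'}
  zero_mem' := by
    refine ⟨0, 0, ⟨?_, integrable_zero _ _ _, ?_⟩, by simp, Lp.coeFn_zero _ _ _, ?_⟩
    · simp [AbsolutelyContinuousOnInterval, tendsto_const_nhds]
    · exact Eventually.of_forall fun x => hasDerivAt_const x 0
    · refine (Lp.coeFn_zero _ _ _).trans (Eventually.of_forall fun x => ?_)
      simp [diffExpr]
  add_mem' := by
    rintro p q ⟨y, y', hy, hb, h1, h2⟩ ⟨z, z', hz, hc, k1, k2⟩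
    refine ⟨y + z, y' + z', ⟨hy.1.add hz.1, hy.2.add hz.2, ?_⟩, ?_, ?_, ?_⟩
    · filter_upwards [hy.3, hz.3] with x a c using a.add c
    · simp only [Pi.add_apply, WithLp.ofLp_add, Matrix.mulVec_add]
      rw [add_add_add_comm, hb, hc, add_zero]
    · exact (Lp.coeFn_add _ _).trans (h1.add k1)
    · refine (Lp.coeFn_add _ _).trans ((h2.add k2).trans (Eventually.of_forall fun x => ?_))
      simp only [diffExpr, Pi.add_apply, WithLp.ofLp_add, Matrix.mulVec_add, smul_add,
        ← WithLp.toLp_add]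
      congr 1
      abel
  smul_mem' := by
    rintro c p ⟨y, y', hy, hb, h1, h2⟩
    refine ⟨fun x => c • y x, fun x => c • y' x,
      ⟨hy.1.const_smul c, hy.2.smul c, ?_⟩, ?_, ?_, ?_⟩
    · filter_upwards [hy.3] with x a using a.const_smul c
    · simp only [WithLp.ofLp_smul, Matrix.mulVec_smul]
      rw [← smul_add, hb, smul_zero]
    · exact (Lp.coeFn_smul _ _).trans (h1.const_smul c)
    · refine (Lp.coeFn_smul _ _).trans ((h2.const_smul c).trans (Eventually.of_forall fun x => ?_))
      simp only [Pi.smul_apply, diffExpr, WithLp.ofLp_smul, Matrix.mulVec_smul,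
        ← WithLp.toLp_smul]
      rw [smul_add, smul_comm c]

/-- The operator `L_{C,D}(Q)` in `L²([0, 1]; ℂⁿ)`; its graph is `opGraph`, see `graph_op`. -/
def op {n : ℕ} (b : Fin n → ℂ) (C D : Matrix (Fin n) (Fin n) ℂ)
    (Q : ℝ → Matrix (Fin n) (Fin n) ℂ) : L2 n →ₗ.[ℂ] L2 n :=
  (opGraph b C D Q).toLinearPMap

theorem opGraph_functional {n : ℕ} (b : Fin n → ℂ) (C D : Matrix (Fin n) (Fin n) ℂ)
    (Q : ℝ → Matrix (Fin n) (Fin n) ℂ) (p : L2 n × L2 n) (hp : p ∈ opGraph b C D Q)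
    (hp0 : p.1 = 0) : p.2 = 0 := by
  obtain ⟨y, y', hy, -, h1, h2⟩ := hp
  rw [hp0] at h1
  have hae : y =ᵐ[unitVolume] (fun _ => 0) := h1.symm.trans (Lp.coeFn_zero _ _ _)
  have hcont : ContinuousOn y (Set.Icc 0 1) := by
    simpa using hy.absCont.continuousOn
  have hEq : Set.EqOn y (fun _ => 0) (Set.Icc 0 1) :=
    Measure.eqOn_Icc_of_ae_eq volume zero_ne_one hae hcont continuousOn_const
  have hIoo : ∀ᵐ x ∂unitVolume, x ∈ Set.Ioo (0 : ℝ) 1 := by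
    rw [unitVolume, ← restrict_Ioo_eq_restrict_Icc]
    exact ae_restrict_mem measurableSet_Ioo
  refine Lp.ext (h2.trans ?_)
  refine EventuallyEq.trans ?_ (Lp.coeFn_zero _ _ _).symm
  filter_upwards [hIoo, hy.hasDeriv] with x hx hd
  have hloc : y =ᶠ[𝓝 x] fun _ => 0 := by
    filter_upwards [Ioo_mem_nhds hx.1 hx.2] with t ht using hEq ⟨ht.1.le, ht.2.le⟩
  have hd0 : y' x = 0 := hd.unique ((hasDerivAt_const x 0).congr_of_eventuallyEq hloc)
  have hy0 : y x = 0 := hEq ⟨hx.1.le, hx.2.le⟩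
  simp [diffExpr, hd0, hy0]

theorem graph_op {n : ℕ} (b : Fin n → ℂ) (C D : Matrix (Fin n) (Fin n) ℂ)
    (Q : ℝ → Matrix (Fin n) (Fin n) ℂ) : (op b C D Q).graph = opGraph b C D Q :=
  Submodule.toLinearPMap_graph_eq _ (opGraph_functional b C D Q)

end

end DiracBVP

namespace DiracBVP

/-!
The resolvent `R` at `z` solves `y' = i B (f + (z - Q) y)`, `y = R f`, so up to a constant of
integration it differs from the leading term `f ↦ i B ∫₀ˣ f` by `i B ∫₀ˣ (z - Q) R f`. Put
`W x = x + ∫₀ˣ ‖z - Q‖`. If `R f` vanishes at the points of a net of `k` points equidistant for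
`W`, then `R f` is `O(k^(-1/2) ‖f‖)`, and if the difference vanishes there too, it is
`O(k^(-3/2) ‖f‖)`. Hence the `k`-th Gelfand number of the difference, which is its `k`-th singular
value, is `o(1/k)`, and by the subadditivity of singular values the difference does not affect
first-order asymptotics.

Off the constants, the leading term is diagonal in the Fourier basis up to finite rank, with entries
of modulus `|b_j| / (2 π |k|)` for `k ≠ 0`. Counting them gives `k s_k → ∑ j, |b_j| / π`. The `n`
subsequences are the fibres of a greedy colouring of `ℕ` in which the `j`-th colour has density
`|b_j| / ∑ i, |b_i|`.
-/

section GelfandNumbers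

variable {𝕜 E F G : Type*} [Field 𝕜] [SeminormedAddCommGroup E] [Module 𝕜 E]
  [SeminormedAddCommGroup F] [Module 𝕜 F] [SeminormedAddCommGroup G] [Module 𝕜 G]
  {S T : E →ₗ[𝕜] F} {k l : ℕ} {s t : ℝ}

/-- The `(k + 1)`-st Gelfand number of `T` is at most `t`: on the common kernel of some `k` linear
functionals, `T` is bounded by `t`. The functionals need not be continuous. -/
def GelfandLE (T : E →ₗ[𝕜] F) (k : ℕ) (t : ℝ) : Prop :=
  ∃ Λ : E →ₗ[𝕜] (Fin k → 𝕜), ∀ f, Λ f = 0 → ‖T f‖ ≤ t * ‖f‖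

theorem gelfandLE_of_ker {V : Type*} [AddCommGroup V] [Module 𝕜 V] [FiniteDimensional 𝕜 V]
    (hk : Module.finrank 𝕜 V ≤ k) (Λ : E →ₗ[𝕜] V) (h : ∀ f, Λ f = 0 → ‖T f‖ ≤ t * ‖f‖) :
    GelfandLE T k t := by
  obtain ⟨ι, hι⟩ : ∃ ι : V →ₗ[𝕜] (Fin k → 𝕜), Function.Injective ι :=
    finrank_le_iff_exists_linearMap.1 (by simpa using hk)
  exact ⟨ι ∘ₗ Λ, fun f hf => h f (hι (by simpa using hf))⟩

theorem GelfandLE.mono (h : GelfandLE T k s) (hkl : k ≤ l) (hst : s ≤ t) : GelfandLE T l t := by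
  obtain ⟨Λ, hΛ⟩ := h
  exact gelfandLE_of_ker (by simpa using hkl) Λ fun f hf => (hΛ f hf).trans (by gcongr)

theorem GelfandLE.of_norm_le {T' : E →ₗ[𝕜] G} (h : GelfandLE T k t)
    (hT : ∀ f, ‖T' f‖ ≤ ‖T f‖) : GelfandLE T' k t :=
  h.imp fun _ hΛ f hf => (hT f).trans (hΛ f hf)

theorem GelfandLE.add (hS : GelfandLE S k s) (hT : GelfandLE T l t) :
    GelfandLE (S + T) (k + l) (s + t) := by
  obtain ⟨Λ, hΛ⟩ := hS
  obtain ⟨M, hM⟩ := hT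
  refine gelfandLE_of_ker (by simp) (Λ.prod M) fun f hf => ?_
  obtain ⟨hf₁, hf₂⟩ := Prod.mk.inj hf
  calc ‖(S + T) f‖ ≤ ‖S f‖ + ‖T f‖ := norm_add_le _ _
    _ ≤ s * ‖f‖ + t * ‖f‖ := add_le_add (hΛ f hf₁) (hM f hf₂)
    _ = (s + t) * ‖f‖ := by ring

theorem GelfandLE.le_of_le_norm {E : Type*} [NormedAddCommGroup E] [Module 𝕜 E] {T : E →ₗ[𝕜] F}
    (h : GelfandLE T k t) (V : Submodule 𝕜 E) (hk : (k : Cardinal) < Module.rank 𝕜 V)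
    (hV : ∀ f ∈ V, s * ‖f‖ ≤ ‖T f‖) : s ≤ t := by
  obtain ⟨Λ, hΛ⟩ := h
  have hker : LinearMap.ker (Λ.domRestrict V) ≠ ⊥ := fun hbot => by
    have := LinearMap.lift_rank_le_of_injective _ (LinearMap.ker_eq_bot.1 hbot)
    rw [rank_fin_fun, Cardinal.lift_natCast, Cardinal.lift_le_nat_iff] at this
    exact hk.not_ge this
  obtain ⟨⟨f, hfV⟩, hf, hf0⟩ := Submodule.exists_mem_ne_zero_of_ne_bot hker
  have hpos : 0 < ‖f‖ := norm_pos_iff.2 fun h => hf0 (Subtype.ext h)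
  exact le_of_mul_le_mul_right ((hV f hfV).trans (hΛ f hf)) hpos

end GelfandNumbers

section Compactness

variable {E F H : Type*} [NormedAddCommGroup E] [NormedSpace ℂ E] [NormedAddCommGroup F]
  [NormedSpace ℂ F] [NormedAddCommGroup H] [InnerProductSpace ℂ H]

theorem exists_gelfandLE_of_isCompactOperator {T : E →L[ℂ] H} (hT : IsCompactOperator T)
    {ε : ℝ} (hε : 0 < ε) : ∃ k, GelfandLE (T : E →ₗ[ℂ] H) k ε := by
  have htb : TotallyBounded (T '' Metric.closedBall 0 1) :=
    (hT.isCompact_closure_image_closedBall (f := (T : E →ₗ[ℂ] H)) 1).totallyBounded.subset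
      subset_closure
  obtain ⟨Y, -, hY, hcover⟩ := Metric.finite_approx_of_totallyBounded htb ε hε
  have := hY.fintype
  let Λ : E →ₗ[ℂ] (Y → ℂ) := LinearMap.pi fun y => (innerSL ℂ (y : H) ∘L T : E →L[ℂ] ℂ)
  refine ⟨_, gelfandLE_of_ker le_rfl Λ fun f hf => ?_⟩
  have hunit : ‖T ∘L (LinearMap.ker Λ).subtypeL‖ ≤ ε := by
    refine ContinuousLinearMap.opNorm_le_of_unit_norm hε.le fun ⟨g, hg⟩ hg1 => ?_
    obtain ⟨y, hyY, hy⟩ := Set.mem_iUnion₂.1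
      (hcover ⟨g, mem_closedBall_zero_iff.2 hg1.le, rfl⟩)
    have horth : inner ℂ y (T g) = 0 := congrFun (LinearMap.mem_ker.1 hg) ⟨y, hyY⟩
    have hsq : ‖T g‖ * ‖T g‖ ≤ ε * ‖T g‖ := calc
      ‖T g‖ * ‖T g‖ = ‖inner ℂ (T g - y) (T g)‖ := by
        rw [inner_sub_left, horth, sub_zero, inner_self_eq_norm_sq_to_K, norm_pow, sq]
        simp
      _ ≤ ‖T g - y‖ * ‖T g‖ := norm_inner_le_norm _ _
      _ ≤ ε * ‖T g‖ := by gcongr; exact (mem_ball_iff_norm.1 hy).le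
    change ‖T g‖ ≤ ε
    rcases (norm_nonneg (T g)).eq_or_lt with h0 | hpos
    · exact h0 ▸ hε.le
    · exact le_of_mul_le_mul_right hsq hpos
  exact (T ∘L (LinearMap.ker Λ).subtypeL).le_of_opNorm_le hunit ⟨f, hf⟩

theorem GelfandLE.exists_norm_sub_starProjection_le [CompleteSpace H] {T : H →L[ℂ] F} {k : ℕ}
    {t : ℝ} (ht : 0 ≤ t) (hT : GelfandLE (T : H →ₗ[ℂ] F) k t) :
    ∃ (V : Submodule ℂ H) (_ : FiniteDimensional ℂ V), ‖T - T ∘L V.starProjection‖ ≤ t := by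
  obtain ⟨Λ, hΛ⟩ := hT
  let V : Submodule ℂ H := (LinearMap.ker Λ)ᗮ
  have hinj : Function.Injective (Λ.domRestrict V) := by
    rw [← LinearMap.ker_eq_bot, LinearMap.ker_eq_bot']
    rintro ⟨f, hf⟩ h0
    exact Subtype.ext (inner_self_eq_zero.1 (hf f h0))
  have hfin : FiniteDimensional ℂ V := FiniteDimensional.of_injective _ hinj
  refine ⟨V, hfin, ContinuousLinearMap.opNorm_le_bound _ ht fun f => ?_⟩
  have hclosure : ∀ g ∈ closure (LinearMap.ker Λ : Set H), ‖T g‖ ≤ t * ‖g‖ :=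
    closure_minimal hΛ (isClosed_le T.continuous.norm (continuous_const.mul continuous_norm))
  have hmem : f - V.starProjection f ∈ closure (LinearMap.ker Λ : Set H) := by
    rw [← Submodule.topologicalClosure_coe, ← Submodule.orthogonal_orthogonal_eq_closure]
    exact V.sub_starProjection_mem_orthogonal f
  have hproj : ‖f - V.starProjection f‖ ≤ ‖f‖ := by
    rw [← Submodule.starProjection_orthogonal_val]
    exact Vᗮ.norm_starProjection_apply_le f
  calc ‖(T - T ∘L V.starProjection) f‖ = ‖T (f - V.starProjection f)‖ := by simp
    _ ≤ t * ‖f - V.starProjection f‖ := hclosure _ hmem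
    _ ≤ t * ‖f‖ := by gcongr

theorem isCompactOperator_of_gelfandLE [CompleteSpace H] [CompleteSpace F] {T : H →L[ℂ] F}
    (hT : ∀ ε > 0, ∃ k, GelfandLE (T : H →ₗ[ℂ] F) k ε) : IsCompactOperator T := by
  have hmem : T ∈ closure {S : H →L[ℂ] F | IsCompactOperator S} := by
    refine Metric.mem_closure_iff.2 fun ε hε => ?_
    obtain ⟨k, hk⟩ := hT (ε / 2) (half_pos hε)
    obtain ⟨V, hV, hTV⟩ := hk.exists_norm_sub_starProjection_le (half_pos hε).le
    have hcompact : IsCompactOperator (T ∘L V.subtypeL) :=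
      ((isCompactOperator_id_iff_finiteDimensional (𝕜 := ℂ)).2 hV).clm_comp (T ∘L V.subtypeL)
    refine ⟨T ∘L V.starProjection, hcompact.comp_clm V.orthogonalProjectionOnto, ?_⟩
    rw [dist_eq_norm]
    exact hTV.trans_lt (half_lt_self hε)
  rwa [IsClosed.closure_eq isClosed_setOfPred_isCompactOperator] at hmem

end Compactness

section SingularValues

variable {H : Type*} [NormedAddCommGroup H] [InnerProductSpace ℂ H] [CompleteSpace H]
  {S T : H →L[ℂ] H} {k m : ℕ} {t : ℝ} {f : H}

theorem isSymmetric_abs (T : H →L[ℂ] H) :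
    ((CFC.abs T : H →L[ℂ] H) : H →ₗ[ℂ] H).IsSymmetric :=
  (CFC.abs_nonneg T).isSelfAdjoint.isSymmetric

theorem norm_abs_apply (T : H →L[ℂ] H) (f : H) : ‖CFC.abs T f‖ = ‖T f‖ := by
  have hinner : inner ℂ (CFC.abs T f) (CFC.abs T f) = inner ℂ (T f) (T f) := by
    have hsymm : inner ℂ (CFC.abs T f) (CFC.abs T f) = inner ℂ f (CFC.abs T (CFC.abs T f)) :=
      isSymmetric_abs T f (CFC.abs T f)
    rw [hsymm, ← mul_apply_eq_comp, CFC.abs_mul_abs, mul_apply_eq_comp,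
      ContinuousLinearMap.star_eq_adjoint, ContinuousLinearMap.adjoint_inner_right]
  rw [inner_self_eq_norm_sq_to_K, inner_self_eq_norm_sq_to_K] at hinner
  exact (pow_left_inj₀ (norm_nonneg _) (norm_nonneg _) two_ne_zero).1 (by exact_mod_cast hinner)

theorem isCompactOperator_abs (hT : IsCompactOperator T) :
    IsCompactOperator (CFC.abs T : H →L[ℂ] H) :=
  isCompactOperator_of_gelfandLE fun _ hε =>
    (exists_gelfandLE_of_isCompactOperator hT hε).imp fun _ h =>
      h.of_norm_le fun f => (norm_abs_apply T f).le

theorem eigenspace_le_absEigenspan (T : H →L[ℂ] H) {r : ℝ} (h : t ≤ r) :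
    Module.End.eigenspace ((CFC.abs T : H →L[ℂ] H) : H →ₗ[ℂ] H) (r : ℂ) ≤ absEigenspan T t :=
  le_iSup₂_of_le r h le_rfl

theorem le_norm_of_mem_absEigenspan (T : H →L[ℂ] H) (ht : 0 ≤ t) (hf : f ∈ absEigenspan T t) :
    t * ‖f‖ ≤ ‖T f‖ := by
  classical
  have hinj : Function.Injective fun r : {r : ℝ // t ≤ r} => ((r : ℝ) : ℂ) :=
    Complex.ofReal_injective.comp Subtype.val_injective
  have horth := (isSymmetric_abs T).orthogonalFamily_eigenspaces.comp hinj
  rw [absEigenspan, iSup_subtype', Submodule.mem_iSup_iff_exists_dfinsupp'] at hf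
  obtain ⟨v, rfl⟩ := hf
  simp only [DFinsupp.sum]
  set f := ∑ r ∈ v.support, (v r : H) with hf
  have hnorm : ‖f‖ ^ 2 = ∑ r ∈ v.support, ‖v r‖ ^ 2 := horth.norm_sum (fun r => v r) v.support
  have habs : CFC.abs T f = ∑ r ∈ v.support, (((r : ℝ) : ℂ) • (v r) : H) := by
    rw [hf, map_sum]
    exact Finset.sum_congr rfl fun r _ => Module.End.mem_eigenspace_iff.1 (v r).2
  have hnorm_abs : ‖CFC.abs T f‖ ^ 2 = ∑ r ∈ v.support, (r : ℝ) ^ 2 * ‖v r‖ ^ 2 := by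
    rw [habs]
    refine (horth.norm_sum (fun r => ((r : ℝ) : ℂ) • v r) v.support).trans
      (Finset.sum_congr rfl fun r _ => ?_)
    rw [norm_smul, mul_pow, Complex.norm_real, Real.norm_eq_abs, sq_abs]
  rw [← norm_abs_apply]
  refine le_of_sq_le_sq ?_ (norm_nonneg _)
  rw [mul_pow, hnorm, hnorm_abs, Finset.mul_sum]
  refine Finset.sum_le_sum fun r _ => ?_
  have := r.2
  gcongr

theorem abs_apply_mem_absEigenspan (hf : f ∈ absEigenspan T t) :
    CFC.abs T f ∈ absEigenspan T t := by
  suffices absEigenspan T t ≤ (absEigenspan T t).comap (CFC.abs T : H →L[ℂ] H).toLinearMap from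
    this hf
  refine iSup₂_le fun r hr v hv => ?_
  rw [Submodule.mem_comap, Module.End.mem_eigenspace_iff.1 hv]
  exact Submodule.smul_mem _ _ (eigenspace_le_absEigenspan T hr hv)

theorem abs_apply_mem_orthogonal_absEigenspan (hf : f ∈ (absEigenspan T t)ᗮ) :
    CFC.abs T f ∈ (absEigenspan T t)ᗮ := fun u hu =>
  (isSymmetric_abs T u f).symm.trans (hf _ (abs_apply_mem_absEigenspan hu))

theorem hasEigenvalue_norm_of_isCompactOperator (hS : S.IsPositive)
    (hcompact : IsCompactOperator S) (hS0 : S ≠ 0) :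
    Module.End.HasEigenvalue (S : H →ₗ[ℂ] H) (‖S‖ : ℂ) := by
  have : Nontrivial H := by
    by_contra! h
    exact hS0 (ContinuousLinearMap.ext fun x => Subsingleton.elim _ _)
  obtain ⟨μ, hμ, hμS⟩ := spectrum.exists_nnnorm_eq_spectralRadius S
  rw [S.spectralRadius_eq_nnnorm hS.isSelfAdjoint, ENNReal.coe_inj] at hμS
  have hnorm : ‖μ‖ = ‖S‖ := congrArg NNReal.toReal hμS
  have hμ0 : μ ≠ 0 := norm_pos_iff.1 (hnorm ▸ norm_pos_iff.2 hS0)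
  have hμ_eig := (hcompact.hasEigenvalue_iff_mem_spectrum hμ0).2 hμ
  have hreal : (μ.re : ℂ) = μ :=
    Complex.conj_eq_iff_re.1 (hS.isSymmetric.conj_eigenvalue_eq_self hμ_eig)
  have hnonneg : 0 ≤ μ.re :=
    eigenvalue_nonneg_of_nonneg (hreal.symm ▸ hμ_eig) fun x => hS.re_inner_nonneg_right x
  rwa [← hnorm, ← hreal, Complex.norm_real, Real.norm_of_nonneg hnonneg, hreal]

theorem norm_lt_of_mem_orthogonal_absEigenspan (hT : IsCompactOperator T) (ht : 0 < t)
    (hf : f ∈ (absEigenspan T t)ᗮ) (hf0 : f ≠ 0) : ‖T f‖ < t * ‖f‖ := by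
  by_contra! hle
  rw [← norm_abs_apply] at hle
  let W := (absEigenspan T t)ᗮ
  have hinv : ∀ g ∈ W, CFC.abs T g ∈ W := fun g => abs_apply_mem_orthogonal_absEigenspan
  let S : W →L[ℂ] W := (CFC.abs T).restrict hinv
  have hcompact : IsCompactOperator S :=
    (isCompactOperator_abs hT).restrict' (f := (CFC.abs T : H →L[ℂ] H).toLinearMap) hinv
  have habs : (CFC.abs T).IsPositive :=
    (ContinuousLinearMap.nonneg_iff_isPositive _).1 (CFC.abs_nonneg T)
  have hpos : S.IsPositive :=
    ⟨habs.isSymmetric.restrict_invariant hinv, fun x => habs.re_inner_nonneg_left (x : H)⟩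
  have hnorm : t ≤ ‖S‖ :=
    le_of_mul_le_mul_right (hle.trans (S.le_opNorm ⟨f, hf⟩)) (norm_pos_iff.2 hf0)
  obtain ⟨v, hv⟩ := (hasEigenvalue_norm_of_isCompactOperator hpos hcompact
    (norm_pos_iff.1 (ht.trans_le hnorm))).exists_hasEigenvector
  have hv_mem : (v : H) ∈ absEigenspan T t :=
    eigenspace_le_absEigenspan T hnorm
      (Module.End.mem_eigenspace_iff.2 (congrArg Subtype.val hv.apply_eq_smul))
  exact hv.2 (Subtype.ext (inner_self_eq_zero.1 (v.2 (v : H) hv_mem)))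

theorem le_of_lt_rank_absEigenspan {s : ℝ} (ht : 0 ≤ t)
    (hk : (k : Cardinal) < Module.rank ℂ (absEigenspan T t))
    (hT : GelfandLE (T : H →ₗ[ℂ] H) k s) : t ≤ s :=
  hT.le_of_le_norm _ hk fun _ => le_norm_of_mem_absEigenspan T ht

theorem singularValue_le (ht : 0 ≤ t) (hT : GelfandLE (T : H →ₗ[ℂ] H) k t) :
    singularValue T k ≤ t :=
  Real.sSup_le (fun _ hs => le_of_lt_rank_absEigenspan hs.1.le hs.2 hT) ht

theorem bddAbove_singularValue (T : H →L[ℂ] H) (k : ℕ) :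
    BddAbove {t : ℝ | 0 < t ∧ (k : Cardinal) < Module.rank ℂ (absEigenspan T t)} :=
  ⟨‖T‖, fun _ ht => le_of_lt_rank_absEigenspan ht.1.le ht.2 ⟨0, fun f _ => T.le_opNorm f⟩⟩

theorem singularValue_nonneg (T : H →L[ℂ] H) (k : ℕ) : 0 ≤ singularValue T k :=
  Real.sSup_nonneg fun _ ht => ht.1.le

theorem gelfandLE_of_singularValue_lt (hT : IsCompactOperator T) (ht : singularValue T k < t) :
    GelfandLE (T : H →ₗ[ℂ] H) k t := by
  have ht0 : 0 < t := (singularValue_nonneg T k).trans_lt ht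
  have hrank : Module.rank ℂ (absEigenspan T t) ≤ k := by
    by_contra! hlt
    exact ht.not_ge (le_csSup (bddAbove_singularValue T k) ⟨ht0, hlt⟩)
  have : FiniteDimensional ℂ (absEigenspan T t) :=
    Module.rank_lt_aleph0_iff.1 (hrank.trans_lt Cardinal.natCast_lt_aleph0)
  refine gelfandLE_of_ker (Module.finrank_le_of_rank_le hrank)
    ((absEigenspan T t).orthogonalProjectionOnto : H →ₗ[ℂ] absEigenspan T t) fun f hf => ?_
  rcases eq_or_ne f 0 with rfl | hf0
  · simp
  · exact (norm_lt_of_mem_orthogonal_absEigenspan hT ht0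
      (Submodule.orthogonalProjectionOnto_eq_zero_iff.1 hf) hf0).le

theorem singularValue_antitone (T : H →L[ℂ] H) : Antitone (singularValue T) :=
  fun k _ hkl => Real.sSup_le
    (fun _ ht => le_csSup (bddAbove_singularValue T k)
      ⟨ht.1, (Nat.cast_le.2 hkl).trans_lt ht.2⟩) (singularValue_nonneg T k)

theorem le_singularValue (hT : IsCompactOperator T) (V : Submodule ℂ H)
    (hk : (k : Cardinal) < Module.rank ℂ V) (hV : ∀ f ∈ V, t * ‖f‖ ≤ ‖T f‖) :
    t ≤ singularValue T k :=
  le_of_forall_gt_imp_ge_of_dense fun _ hs =>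
    (gelfandLE_of_singularValue_lt hT hs).le_of_le_norm V hk hV

theorem singularValue_add_le (hS : IsCompactOperator S) (hT : IsCompactOperator T) (k m : ℕ) :
    singularValue (S + T) (k + m) ≤ singularValue S k + singularValue T m := by
  refine le_of_forall_pos_le_add fun ε hε => ?_
  have hS' := gelfandLE_of_singularValue_lt hS
    (lt_add_of_pos_right (singularValue S k) (half_pos hε))
  have hT' := gelfandLE_of_singularValue_lt hT
    (lt_add_of_pos_right (singularValue T m) (half_pos hε))
  have := singularValue_nonneg S k
  have := singularValue_nonneg T m
  exact (singularValue_le (by positivity) (hS'.add hT')).trans_eq (by ring)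

end SingularValues

section Perturbation

theorem tendsto_succ_mul_comp {u : ℕ → ℝ} {f : ℕ → ℕ} {a c : ℝ} (hc : 0 < c)
    (hu : Tendsto (fun N : ℕ => ((N : ℝ) + 1) * u N) atTop (𝓝 a))
    (hf : Tendsto (fun N : ℕ => (f N : ℝ) / N) atTop (𝓝 c)) :
    Tendsto (fun N : ℕ => ((N : ℝ) + 1) * u (f N)) atTop (𝓝 (a / c)) := by
  have hf_top : Tendsto f atTop atTop := by
    have h : Tendsto (fun N : ℕ => (f N : ℝ) / N * N) atTop atTop :=
      hf.pos_mul_atTop hc tendsto_natCast_atTop_atTop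
    refine tendsto_natCast_atTop_iff.1 (h.congr' ?_)
    filter_upwards [eventually_ne_atTop 0] with N hN
    field_simp
  have hratio : Tendsto (fun N : ℕ => ((f N : ℝ) + 1) / (N + 1)) atTop (𝓝 c) := by
    have h : Tendsto (fun N : ℕ => (f N : ℝ) / N * (N / (N + 1)) + 1 / (N + 1)) atTop
        (𝓝 (c * 1 + 0)) :=
      (hf.mul (tendsto_natCast_div_add_atTop 1)).add tendsto_one_div_add_atTop_nhds_zero_nat
    rw [mul_one, add_zero] at h
    refine h.congr' ?_
    filter_upwards [eventually_ne_atTop 0] with N hN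
    field_simp
  refine ((hu.comp hf_top).div hratio hc.ne').congr fun N => ?_
  simp only [Pi.div_apply, Function.comp_apply]
  field_simp

theorem tendsto_floor_natCast_mul_div {δ : ℝ} (hδ : 0 ≤ δ) :
    Tendsto (fun N : ℕ => (⌊δ * N⌋₊ : ℝ) / N) atTop (𝓝 δ) :=
  (tendsto_nat_floor_mul_div_atTop hδ).comp tendsto_natCast_atTop_atTop

variable {H : Type*} [NormedAddCommGroup H] [InnerProductSpace ℂ H] [CompleteSpace H]
  {S T : H →L[ℂ] H} {a : ℝ}

theorem singularValue_neg (T : H →L[ℂ] H) : singularValue (-T) = singularValue T := by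
  have habs : (CFC.abs (-T) : H →L[ℂ] H) = CFC.abs T := CFC.abs_neg T
  funext k
  unfold singularValue absEigenspan
  rw [habs]

theorem eventually_succ_mul_singularValue_add_lt (hS : IsCompactOperator S)
    (hT : IsCompactOperator T)
    (hSlim : Tendsto (fun N : ℕ => ((N : ℝ) + 1) * singularValue S N) atTop (𝓝 a))
    (hTlim : Tendsto (fun N : ℕ => ((N : ℝ) + 1) * singularValue T N) atTop (𝓝 0))
    {x : ℝ} (hx : a < x) : ∀ᶠ N : ℕ in atTop, ((N : ℝ) + 1) * singularValue (S + T) N < x := by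
  have hcont : Tendsto (fun δ : ℝ => a / (1 - δ)) (𝓝[>] 0) (𝓝 a) := by
    have h : ContinuousAt (fun δ : ℝ => a / (1 - δ)) 0 :=
      continuousAt_const.div (by fun_prop) (by norm_num)
    simpa using h.tendsto.mono_left nhdsWithin_le_nhds
  obtain ⟨δ, hδx, hδ0, hδ1⟩ :=
    ((hcont.eventually_lt_const hx).and (Ioo_mem_nhdsGT one_pos)).exists
  have hle : ∀ N : ℕ, ⌊δ * N⌋₊ ≤ N := fun N =>
    Nat.floor_le_of_le (mul_le_of_le_one_left N.cast_nonneg hδ1.le)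
  have hfloor := tendsto_floor_natCast_mul_div hδ0.le
  have hfloor' : Tendsto (fun N : ℕ => ((N - ⌊δ * N⌋₊ : ℕ) : ℝ) / N) atTop (𝓝 (1 - δ)) := by
    refine (hfloor.const_sub 1).congr' ?_
    filter_upwards [eventually_ne_atTop 0] with N hN
    rw [Nat.cast_sub (hle N)]
    field_simp
  have hlim := (tendsto_succ_mul_comp (sub_pos.2 hδ1) hSlim hfloor').add
    (tendsto_succ_mul_comp hδ0 hTlim hfloor)
  rw [zero_div, add_zero] at hlim
  filter_upwards [hlim.eventually_lt_const hδx] with N hN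
  refine lt_of_le_of_lt ?_ hN
  rw [← mul_add]
  gcongr
  have h := singularValue_add_le hS hT (N - ⌊δ * N⌋₊) ⌊δ * N⌋₊
  rwa [Nat.sub_add_cancel (hle N)] at h

theorem eventually_lt_succ_mul_singularValue_add (hS : IsCompactOperator S)
    (hT : IsCompactOperator T)
    (hSlim : Tendsto (fun N : ℕ => ((N : ℝ) + 1) * singularValue S N) atTop (𝓝 a))
    (hTlim : Tendsto (fun N : ℕ => ((N : ℝ) + 1) * singularValue T N) atTop (𝓝 0))
    {x : ℝ} (hx : x < a) : ∀ᶠ N : ℕ in atTop, x < ((N : ℝ) + 1) * singularValue (S + T) N := by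
  have hcont : Tendsto (fun δ : ℝ => a / (1 + δ)) (𝓝[>] 0) (𝓝 a) := by
    have h : ContinuousAt (fun δ : ℝ => a / (1 + δ)) 0 :=
      continuousAt_const.div (by fun_prop) (by norm_num)
    simpa using h.tendsto.mono_left nhdsWithin_le_nhds
  obtain ⟨δ, hδx, hδ0 : 0 < δ⟩ :=
    ((hcont.eventually_const_lt hx).and self_mem_nhdsWithin).exists
  have hfloor := tendsto_floor_natCast_mul_div hδ0.le
  have hfloor' : Tendsto (fun N : ℕ => ((N + ⌊δ * N⌋₊ : ℕ) : ℝ) / N) atTop (𝓝 (1 + δ)) := by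
    refine (hfloor.const_add 1).congr' ?_
    filter_upwards [eventually_ne_atTop 0] with N hN
    rw [Nat.cast_add]
    field_simp
  have hlim := (tendsto_succ_mul_comp (by positivity) hSlim hfloor').sub
    (tendsto_succ_mul_comp hδ0 hTlim hfloor)
  rw [zero_div, sub_zero] at hlim
  filter_upwards [hlim.eventually_const_lt hδx] with N hN
  refine hN.trans_le ?_
  rw [← mul_sub]
  gcongr
  have hneg : IsCompactOperator (-T : H →L[ℂ] H) := hT.neg
  have hsum : IsCompactOperator (S + T : H →L[ℂ] H) := hS.add hT
  have h := singularValue_add_le hsum hneg N ⌊δ * N⌋₊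
  rwa [singularValue_neg, add_neg_cancel_right, ← sub_le_iff_le_add] at h

theorem tendsto_succ_mul_singularValue_add (hS : IsCompactOperator S) (hT : IsCompactOperator T)
    (hSlim : Tendsto (fun N : ℕ => ((N : ℝ) + 1) * singularValue S N) atTop (𝓝 a))
    (hTlim : Tendsto (fun N : ℕ => ((N : ℝ) + 1) * singularValue T N) atTop (𝓝 0)) :
    Tendsto (fun N : ℕ => ((N : ℝ) + 1) * singularValue (S + T) N) atTop (𝓝 a) :=
  tendsto_order.2
    ⟨fun _ => eventually_lt_succ_mul_singularValue_add hS hT hSlim hTlim,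
      fun _ => eventually_succ_mul_singularValue_add_lt hS hT hSlim hTlim⟩

end Perturbation

section Subsequences

variable {P : ℕ → Prop} [DecidablePred P] {d : ℝ}

theorem infinite_of_tendsto_count_div (hd : 0 < d)
    (h : Tendsto (fun N : ℕ => (Nat.count P N : ℝ) / N) atTop (𝓝 d)) : {m | P m}.Infinite := by
  intro hfin
  have hle : ∀ N, Nat.count P N ≤ hfin.toFinset.card := fun N => by
    rw [Nat.count_eq_card_filter_range]
    exact Finset.card_le_card fun m hm => hfin.mem_toFinset.2 (Finset.mem_filter.1 hm).2
  have hzero : Tendsto (fun N : ℕ => (Nat.count P N : ℝ) / N) atTop (𝓝 0) :=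
    squeeze_zero (fun N => by positivity)
      (fun N => div_le_div_of_nonneg_right (Nat.cast_le.2 (hle N)) N.cast_nonneg)
      (tendsto_const_div_atTop_nhds_zero_nat (hfin.toFinset.card : ℝ))
  exact hd.ne (tendsto_nhds_unique hzero h)

theorem tendsto_succ_div_nth_succ (hd : 0 < d)
    (h : Tendsto (fun N : ℕ => (Nat.count P N : ℝ) / N) atTop (𝓝 d)) :
    Tendsto (fun k : ℕ => ((k : ℝ) + 1) / (Nat.nth P k + 1)) atTop (𝓝 d) := by
  have hinf := infinite_of_tendsto_count_div hd h
  have hnth : Tendsto (fun k => Nat.nth P k + 1) atTop atTop :=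
    (tendsto_add_atTop_nat 1).comp (Nat.nth_strictMono hinf).tendsto_atTop
  refine (h.comp hnth).congr fun k => ?_
  simp only [Function.comp_apply, Nat.count_nth_succ_of_infinite hinf, Nat.cast_succ]

theorem bijective_nth_fibers {ι : Type*} {c : ℕ → ι} (hc : ∀ j, {m | c m = j}.Infinite) :
    Function.Bijective fun q : ι × ℕ => Nat.nth (c · = q.1) q.2 := by
  have hcolour : ∀ j k, c (Nat.nth (c · = j) k) = j := fun j => Nat.nth_mem_of_infinite (hc j)
  classical
  constructor
  · rintro ⟨i, k⟩ ⟨j, l⟩ (h : Nat.nth (c · = i) k = Nat.nth (c · = j) l)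
    obtain rfl : i = j := by rw [← hcolour i k, h, hcolour]
    exact Prod.ext rfl (Nat.nth_injective (hc i) h)
  · exact fun m => ⟨(c m, Nat.count (c · = c m) m), Nat.nth_count rfl⟩

end Subsequences

section Densities

variable {ι : Type*} [Fintype ι] [Nonempty ι]

/-- The colour for position `N` of the greedy colouring with target densities `p`: one maximizing
the deficit `(N + 1) p j - a j`, where `a j` counts the earlier positions of colour `j`. -/
noncomputable def greedyChoice (p : ι → ℝ) (N : ℕ) (a : ι → ℕ) : ι :=
  (Finite.exists_max fun j => ((N : ℝ) + 1) * p j - a j).choose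

variable [DecidableEq ι]

/-- The number of positions below `N` of each colour in the greedy colouring of `ℕ`. -/
noncomputable def greedyCount (p : ι → ℝ) : ℕ → ι → ℕ
  | 0 => 0
  | N + 1 => greedyCount p N + Pi.single (greedyChoice p N (greedyCount p N)) 1

/-- The greedy colouring of `ℕ` with densities `p`. -/
noncomputable def greedyColour (p : ι → ℝ) (N : ℕ) : ι :=
  greedyChoice p N (greedyCount p N)

theorem greedyCount_succ_apply (p : ι → ℝ) (N : ℕ) (j : ι) :
    greedyCount p (N + 1) j = greedyCount p N j + if greedyColour p N = j then 1 else 0 := by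
  rw [greedyCount, Pi.add_apply, Pi.single_apply]
  simp only [greedyColour, eq_comm]

theorem count_greedyColour (p : ι → ℝ) (j : ι) (N : ℕ) :
    Nat.count (greedyColour p · = j) N = greedyCount p N j := by
  induction N with
  | zero => simp [greedyCount]
  | succ N ih => rw [Nat.count_succ, ih, greedyCount_succ_apply]

theorem sum_greedyCount (p : ι → ℝ) (N : ℕ) : ∑ j, greedyCount p N j = N := by
  induction N with
  | zero => simp [greedyCount]
  | succ N ih => simp [greedyCount_succ_apply, Finset.sum_add_distrib, ih]

variable {p : ι → ℝ}

theorem greedyCount_greedyColour_lt (hsum : ∑ j, p j = 1) (N : ℕ) :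
    (greedyCount p N (greedyColour p N) : ℝ) < (N + 1) * p (greedyColour p N) := by
  have hcount : ∑ i, (greedyCount p N i : ℝ) = N := by exact_mod_cast sum_greedyCount p N
  obtain ⟨i, -, hi⟩ : ∃ i ∈ Finset.univ, (greedyCount p N i : ℝ) < (N + 1) * p i := by
    refine Finset.exists_lt_of_sum_lt ?_
    rw [hcount, ← Finset.mul_sum, hsum]
    linarith
  have hmax : (N + 1) * p i - greedyCount p N i ≤
      (N + 1) * p (greedyColour p N) - greedyCount p N (greedyColour p N) :=
    (Finite.exists_max fun j => ((N : ℝ) + 1) * p j - greedyCount p N j).choose_spec i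
  linarith

theorem greedyCount_lt (hp : ∀ j, 0 ≤ p j) (hsum : ∑ j, p j = 1) (N : ℕ) (j : ι) :
    (greedyCount p N j : ℝ) < N * p j + 1 := by
  induction N with
  | zero => simp [greedyCount]
  | succ N ih =>
    have := hp j
    rw [greedyCount_succ_apply]
    split_ifs with h
    · have := h ▸ greedyCount_greedyColour_lt hsum N
      push_cast
      linarith
    · push_cast
      linarith

theorem le_greedyCount (hp : ∀ j, 0 ≤ p j) (hsum : ∑ j, p j = 1) (N : ℕ) (j : ι) :
    N * p j - Fintype.card ι ≤ greedyCount p N j := by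
  have hcount : ∑ i, (greedyCount p N i : ℝ) = N := by exact_mod_cast sum_greedyCount p N
  have hnonneg : ∀ i ∈ Finset.univ, 0 ≤ N * p i + 1 - greedyCount p N i :=
    fun i _ => sub_nonneg.2 (greedyCount_lt hp hsum N i).le
  have hle := Finset.single_le_sum hnonneg (Finset.mem_univ j)
  simp only [Finset.sum_sub_distrib, Finset.sum_add_distrib, ← Finset.mul_sum, hsum, hcount,
    Finset.sum_const, Finset.card_univ, nsmul_eq_mul] at hle
  linarith

theorem tendsto_count_greedyColour_div (hp : ∀ j, 0 ≤ p j) (hsum : ∑ j, p j = 1) (j : ι) :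
    Tendsto (fun N : ℕ => (Nat.count (greedyColour p · = j) N : ℝ) / N) atTop (𝓝 (p j)) := by
  have herror := tendsto_const_div_atTop_nhds_zero_nat (Fintype.card ι : ℝ)
  refine tendsto_of_tendsto_of_tendsto_of_le_of_le'
    (by simpa only [sub_zero] using herror.const_sub (p j))
    (by simpa only [add_zero] using tendsto_one_div_atTop_nhds_zero_nat.const_add (p j))
    ?_ ?_ <;> filter_upwards [eventually_gt_atTop 0] with N hN <;>
    have hN' : (0 : ℝ) < N := Nat.cast_pos.2 hN
  · rw [count_greedyColour, sub_div' hN'.ne', mul_comm]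
    gcongr
    exact le_greedyCount hp hsum N j
  · rw [count_greedyColour, add_div' _ _ _ hN'.ne', mul_comm]
    gcongr
    exact (greedyCount_lt hp hsum N j).le

end Densities

theorem exists_subsequences_tendsto {ι : Type*} [Fintype ι] [Nonempty ι] {a : ι → ℝ}
    (ha : ∀ j, 0 < a j) {s : ℕ → ℝ}
    (hs : Tendsto (fun N : ℕ => ((N : ℝ) + 1) * s N) atTop (𝓝 (∑ j, a j))) :
    ∃ ν : ι → ℕ → ℕ, (∀ j, StrictMono (ν j)) ∧
      Function.Bijective (fun q : ι × ℕ => ν q.1 q.2) ∧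
      ∀ j, Tendsto (fun k : ℕ => ((k : ℝ) + 1) * s (ν j k)) atTop (𝓝 (a j)) := by
  classical
  have hA : 0 < ∑ j, a j := Finset.sum_pos (fun j _ => ha j) Finset.univ_nonempty
  let p : ι → ℝ := fun j => a j / ∑ i, a i
  have hp : ∀ j, 0 < p j := fun j => div_pos (ha j) hA
  have hsum : ∑ j, p j = 1 := by rw [← Finset.sum_div, div_self hA.ne']
  have hcount := tendsto_count_greedyColour_div (fun j => (hp j).le) hsum
  have hinf := fun j => infinite_of_tendsto_count_div (hp j) (hcount j)
  have hmono := fun j => Nat.nth_strictMono (hinf j)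
  refine ⟨fun j => Nat.nth (greedyColour p · = j), hmono, bijective_nth_fibers hinf, fun j => ?_⟩
  have hlim := (tendsto_succ_div_nth_succ (hp j) (hcount j)).mul
    (hs.comp (hmono j).tendsto_atTop)
  rw [div_mul_cancel₀ _ hA.ne'] at hlim
  refine hlim.congr fun k => ?_
  simp only [Function.comp_apply]
  field_simp

section AbsolutelyContinuous

theorem absolutelyContinuousOnInterval_of_dist_le {X Y : Type*} [PseudoMetricSpace X]
    [PseudoMetricSpace Y] {F : ℝ → X} {g : ℝ → Y} {a b : ℝ}
    (hg : AbsolutelyContinuousOnInterval g a b)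
    (h : ∀ x ∈ Set.uIcc a b, ∀ y ∈ Set.uIcc a b, dist (F x) (F y) ≤ dist (g x) (g y)) :
    AbsolutelyContinuousOnInterval F a b := by
  rw [absolutelyContinuousOnInterval_iff] at hg ⊢
  intro ε hε
  obtain ⟨δ, hδ, H⟩ := hg ε hε
  refine ⟨δ, hδ, fun P hP hlt => lt_of_le_of_lt (Finset.sum_le_sum fun i hi => ?_) (H P hP hlt)⟩
  exact h _ (hP.1 i hi).1 _ (hP.1 i hi).2

variable {F : Type*} [NormedAddCommGroup F] [NormedSpace ℝ F]

theorem absolutelyContinuousOnInterval_integral {f : ℝ → F} {a b : ℝ}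
    (hf : IntervalIntegrable f volume a b) :
    AbsolutelyContinuousOnInterval (fun x => ∫ t in a..x, f t) a b := by
  refine absolutelyContinuousOnInterval_of_dist_le
    (hf.norm.absolutelyContinuousOnInterval_intervalIntegral Set.left_mem_uIcc)
    fun x hx y hy => ?_
  have hax : IntervalIntegrable f volume a x :=
    hf.mono_set (Set.uIcc_subset_uIcc Set.left_mem_uIcc hx)
  have hay : IntervalIntegrable f volume a y :=
    hf.mono_set (Set.uIcc_subset_uIcc Set.left_mem_uIcc hy)
  rw [dist_eq_norm, dist_eq_norm, intervalIntegral.integral_interval_sub_left hax hay,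
    intervalIntegral.integral_interval_sub_left hax.norm hay.norm]
  exact intervalIntegral.norm_integral_le_abs_integral_norm

theorem eq_add_integral_of_ae_hasDerivAt [CompleteSpace F] {y y' : ℝ → F} {a b : ℝ}
    (hy : AbsolutelyContinuousOnInterval y a b) (hy' : IntervalIntegrable y' volume a b)
    (hd : ∀ᵐ x, x ∈ Set.uIcc a b → HasDerivAt y (y' x) x) {x : ℝ} (hx : x ∈ Set.uIcc a b) :
    y x = y a + ∫ t in a..x, y' t := by
  have hac : AbsolutelyContinuousOnInterval (y - fun x => ∫ t in a..x, y' t) a b :=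
    hy.sub (absolutelyContinuousOnInterval_integral hy')
  obtain ⟨c, hc⟩ := hac.const_of_ae_hasDerivAt_zero (by
    filter_upwards [hd, hy'.ae_hasDerivAt_integral] with x hyx hintx hx
    simpa using (hyx hx).sub (hintx hx a Set.left_mem_uIcc))
  have hcx := hc x hx
  have hca := hc a Set.left_mem_uIcc
  simp only [Pi.sub_apply, intervalIntegral.integral_same, sub_zero] at hcx hca
  rwa [← hca, sub_eq_iff_eq_add] at hcx

end AbsolutelyContinuous

section Nets

theorem exists_fin_forall_abs_sub_le {X : Type*} [TopologicalSpace X] [PreconnectedSpace X]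
    {W : X → ℝ} (hW : Continuous W) {x₀ x₁ : X} (hx : ∀ x, W x ∈ Set.Icc (W x₀) (W x₁)) {k : ℕ}
    (hk : k ≠ 0) : ∃ g : Fin (k + 1) → X, ∀ x, ∃ i, |W x - W (g i)| ≤ (W x₁ - W x₀) / k := by
  have hM : 0 ≤ (W x₁ - W x₀) / k := div_nonneg (sub_nonneg.2 (hx x₀).2) k.cast_nonneg
  have hk' : (k : ℝ) ≠ 0 := Nat.cast_ne_zero.2 hk
  have hgrid (i : Fin (k + 1)) : ∃ x, W x = W x₀ + i * ((W x₁ - W x₀) / k) := by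
    refine mem_range_of_exists_le_of_exists_ge hW
      ⟨x₀, le_add_of_nonneg_right (mul_nonneg (Nat.cast_nonneg _) hM)⟩ ⟨x₁, ?_⟩
    calc W x₀ + i * ((W x₁ - W x₀) / k) ≤ W x₀ + k * ((W x₁ - W x₀) / k) := by
          gcongr
          exact i.is_le
      _ = W x₁ := by field_simp; ring
  choose g hg using hgrid
  refine ⟨g, fun x => ?_⟩
  rcases hM.eq_or_lt with h₀ | hpos
  · refine ⟨0, ?_⟩
    have hW₁ : W x₁ = W x₀ := by
      rcases div_eq_zero_iff.1 h₀.symm with h | h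
      · exact sub_eq_zero.1 h
      · exact absurd h hk'
    have hWx : W x = W x₀ := le_antisymm (hW₁ ▸ (hx x).2) (hx x).1
    rw [hg, hWx, ← h₀]
    simp
  · set q := (W x - W x₀) / ((W x₁ - W x₀) / k) with hq
    have hq₀ : 0 ≤ q := div_nonneg (sub_nonneg.2 (hx x).1) hM
    have hqk : q ≤ k := by
      rw [hq, div_le_iff₀ hpos, mul_div_cancel₀ _ hk']
      exact sub_le_sub_right (hx x).2 _
    refine ⟨⟨⌊q⌋₊, Nat.lt_succ_of_le (Nat.floor_le_of_le hqk)⟩, ?_⟩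
    have hWq : W x - W x₀ = q * ((W x₁ - W x₀) / k) := (div_mul_cancel₀ _ hpos.ne').symm
    rw [hg, ← sub_sub, hWq, ← sub_mul, abs_mul, abs_of_pos hpos]
    refine mul_le_of_le_one_left hM ?_
    rw [abs_of_nonneg (sub_nonneg.2 (Nat.floor_le hq₀)), sub_le_iff_le_add']
    exact (Nat.lt_floor_add_one q).le

variable {X K F : Type*} [SeminormedAddCommGroup X] [Module ℂ X] [TopologicalSpace K]
  [CompactSpace K] [ConnectedSpace K] [NormedAddCommGroup F] [NormedSpace ℂ F]
  [FiniteDimensional ℂ F]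

/- On the common kernel of the values of `Y f` and `Z f` at the nodes of a `W`-net of mesh `δ`, the
first estimate bootstraps to `‖Y f‖ ≤ 2 β √δ ‖f‖`, and the second one gains a further factor `δ`. -/
theorem gelfandLE_of_norm_sub_le {Y Z : X →ₗ[ℂ] C(K, F)} {W : K → ℝ} (hW : Continuous W)
    {x₀ x₁ : K} (hx : ∀ x, W x ∈ Set.Icc (W x₀) (W x₁)) {β : ℝ} (hβ : 0 ≤ β)
    (hY : ∀ f x s, ‖Y f x - Y f s‖ ≤ β * (√|W x - W s| * ‖f‖ + |W x - W s| * ‖Y f‖))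
    (hZ : ∀ f x s, ‖Z f x - Z f s‖ ≤ β * (|W x - W s| * ‖Y f‖)) {k : ℕ} (hk : k ≠ 0) {δ : ℝ}
    (hδ : (W x₁ - W x₀) / k ≤ δ) (hβδ : β * δ ≤ 1 / 2) :
    GelfandLE Z (2 * ((k + 1) * Module.finrank ℂ F)) (2 * β ^ 2 * (δ * √δ)) := by
  obtain ⟨g, hg⟩ := exists_fin_forall_abs_sub_le hW hx hk
  let ev : C(K, F) →ₗ[ℂ] (Fin (k + 1) → F) :=
    { toFun := fun c i => c (g i), map_add' := fun _ _ => rfl, map_smul' := fun _ _ => rfl }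
  refine gelfandLE_of_ker (V := (Fin (k + 1) → F) × (Fin (k + 1) → F))
    (by simp [Module.finrank_pi_fintype, two_mul]) ((ev ∘ₗ Y).prod (ev ∘ₗ Z)) fun f hf => ?_
  obtain ⟨hfY, hfZ⟩ := Prod.mk.inj hf
  have hYg (i) : Y f (g i) = 0 := congrFun hfY i
  have hZg (i) : Z f (g i) = 0 := congrFun hfZ i
  have hδ₀ : 0 ≤ δ := (div_nonneg (sub_nonneg.2 (hx x₀).2) k.cast_nonneg).trans hδ
  have hYf : ‖Y f‖ ≤ β * (√δ * ‖f‖ + δ * ‖Y f‖) := by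
    refine (ContinuousMap.norm_le_of_nonempty _).2 fun x => ?_
    obtain ⟨i, hi⟩ := hg x
    have hxi := hY f x (g i)
    rw [hYg, sub_zero] at hxi
    exact hxi.trans (by gcongr <;> exact hi.trans hδ)
  have hYf' : ‖Y f‖ ≤ 2 * β * (√δ * ‖f‖) := by
    linarith [mul_le_mul_of_nonneg_right hβδ (norm_nonneg (Y f))]
  refine (ContinuousMap.norm_le_of_nonempty _).2 fun x => ?_
  obtain ⟨i, hi⟩ := hg x
  have hxi := hZ f x (g i)
  rw [hZg, sub_zero] at hxi
  calc ‖Z f x‖ ≤ β * (|W x - W (g i)| * ‖Y f‖) := hxi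
    _ ≤ β * (δ * (2 * β * (√δ * ‖f‖))) := by gcongr; exact hi.trans hδ
    _ = 2 * β ^ 2 * (δ * √δ) * ‖f‖ := by ring

end Nets

section GelfandRate

variable {H : Type*} [NormedAddCommGroup H] [InnerProductSpace ℂ H] [CompleteSpace H]

theorem tendsto_succ_mul_singularValue_of_gelfandLE {T : H →L[ℂ] H} {m : ℕ} (hm : 0 < m)
    {u : ℕ → ℝ} (hu₀ : ∀ k, 0 ≤ u k) (hu : Tendsto (fun k : ℕ => k * u k) atTop (𝓝 0))
    (hT : ∀ᶠ k in atTop, GelfandLE (T : H →ₗ[ℂ] H) (m * k) (u k)) :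
    Tendsto (fun N : ℕ => ((N : ℝ) + 1) * singularValue T N) atTop (𝓝 0) := by
  have hdiv : Tendsto (fun N : ℕ => N / m) atTop atTop := Nat.tendsto_div_const_atTop hm.ne'
  have hlim := (hu.comp hdiv).const_mul (2 * m : ℝ)
  rw [mul_zero] at hlim
  refine squeeze_zero' (Eventually.of_forall fun N =>
    mul_nonneg N.cast_add_one_pos.le (singularValue_nonneg T N)) ?_ hlim
  filter_upwards [hdiv.eventually hT, hdiv.eventually_ge_atTop 1] with N hN hN₁
  have hs : singularValue T N ≤ u (N / m) :=
    singularValue_le (hu₀ _) (hN.mono (Nat.mul_div_le N m) le_rfl)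
  have hNm : N + 1 ≤ 2 * m * (N / m) := by
    calc N + 1 ≤ m * (N / m) + m := Nat.lt_mul_div_succ N hm
      _ ≤ m * (N / m) + m * (N / m) := by gcongr; exact Nat.le_mul_of_pos_right m hN₁
      _ = 2 * m * (N / m) := by ring
  calc ((N : ℝ) + 1) * singularValue T N ≤ (2 * m * (N / m : ℕ)) * u (N / m) := by
        gcongr
        · exact singularValue_nonneg T N
        · exact_mod_cast hNm
    _ = 2 * m * ((N / m : ℕ) * u (N / m)) := by ring

end GelfandRate

section Primitive

variable {E : Type*} [NormedAddCommGroup E] {f : ℝ → E} {s t : ℝ}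

theorem intervalIntegrable_of_mem_unitInterval (hf : Integrable f unitVolume)
    (hs : s ∈ unitInterval) (ht : t ∈ unitInterval) : IntervalIntegrable f volume s t := by
  rw [intervalIntegrable_iff]
  exact IntegrableOn.mono_set hf (Set.uIoc_subset_uIcc.trans (Set.uIcc_subset_Icc hs ht))

variable [NormedSpace ℝ E]

theorem integral_sub_integral_of_mem_unitInterval (hf : Integrable f unitVolume)
    (hs : s ∈ unitInterval) (ht : t ∈ unitInterval) :
    (∫ x in (0 : ℝ)..t, f x) - ∫ x in (0 : ℝ)..s, f x = ∫ x in s..t, f x :=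
  intervalIntegral.integral_interval_sub_left
    (intervalIntegrable_of_mem_unitInterval hf unitInterval.zero_mem ht)
    (intervalIntegrable_of_mem_unitInterval hf unitInterval.zero_mem hs)

theorem continuous_integral_unitInterval (hf : Integrable f unitVolume) :
    Continuous fun t : unitInterval => ∫ x in (0 : ℝ)..t, f x := by
  have h := intervalIntegral.continuousOn_primitive_interval (a := 0) (b := 1) (by
    rwa [Set.uIcc_of_le zero_le_one])
  rw [Set.uIcc_of_le zero_le_one] at h
  exact h.domRestrict

theorem integral_congr_of_mem_unitInterval {g : ℝ → E} (hfg : f =ᵐ[unitVolume] g)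
    (hs : s ∈ unitInterval) (ht : t ∈ unitInterval) : ∫ x in s..t, f x = ∫ x in s..t, g x := by
  refine intervalIntegral.integral_congr_ae ?_
  filter_upwards [(ae_restrict_iff' measurableSet_Icc).1 hfg] with x hx hxst
  exact hx (Set.uIoc_subset_uIcc.trans (Set.uIcc_subset_Icc hs ht) hxst)

theorem norm_setIntegral_le_sqrt_mul {α : Type*} [MeasurableSpace α] {μ : Measure α}
    [IsFiniteMeasure μ] (f : Lp E 2 μ) (s : Set α) :
    ‖∫ x in s, f x ∂μ‖ ≤ √(μ.real s) * ‖f‖ := by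
  have hf : MemLp f 2 (μ.restrict s) := (Lp.memLp f).restrict s
  have hle : eLpNorm f 1 (μ.restrict s) ≤ eLpNorm f 2 μ * μ s ^ (1 / 2 : ℝ) := by
    refine (eLpNorm_le_eLpNorm_mul_rpow_measure_univ one_le_two hf.1).trans ?_
    rw [Measure.restrict_apply_univ]
    norm_num
    gcongr
    exact Measure.restrict_le_self
  calc ‖∫ x in s, f x ∂μ‖ ≤ ∫ x in s, ‖f x‖ ∂μ := norm_integral_le_integral_norm _
    _ = (eLpNorm f 1 (μ.restrict s)).toReal := by
        rw [eLpNorm_one_eq_lintegral_enorm, integral_norm_eq_lintegral_enorm hf.1]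
    _ ≤ (eLpNorm f 2 μ * μ s ^ (1 / 2 : ℝ)).toReal :=
        ENNReal.toReal_mono (ENNReal.mul_ne_top (Lp.eLpNorm_ne_top f) (by simp)) hle
    _ = √(μ.real s) * ‖f‖ := by
        rw [ENNReal.toReal_mul, ← ENNReal.toReal_rpow, mul_comm, Real.sqrt_eq_rpow, Lp.norm_def]
        rfl

theorem norm_intervalIntegral_le_sqrt_mul (f : Lp E 2 unitVolume) (hs : s ∈ unitInterval)
    (ht : t ∈ unitInterval) : ‖∫ x in s..t, f x‖ ≤ √|t - s| * ‖f‖ := by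
  have hst : Set.uIoc s t ⊆ Set.Icc 0 1 := Set.uIoc_subset_uIcc.trans (Set.uIcc_subset_Icc hs ht)
  have hrestrict : unitVolume.restrict (Set.uIoc s t) = volume.restrict (Set.uIoc s t) :=
    Measure.restrict_restrict_of_subset hst
  rw [intervalIntegral.norm_intervalIntegral_eq, ← hrestrict]
  refine (norm_setIntegral_le_sqrt_mul f _).trans_eq ?_
  rw [measureReal_def, Measure.restrict_apply measurableSet_uIoc,
    Set.inter_eq_left.2 hst, ← measureReal_def]
  simp [Set.uIoc, Real.volume_real_Ioc, max_sub_min_eq_abs]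

end Primitive

section ContinuousRepresentatives

variable {E : Type*} [NormedAddCommGroup E]

theorem integrable_of_L2 (f : Lp E 2 unitVolume) : Integrable f unitVolume :=
  (Lp.memLp f).integrable one_le_two

theorem memLp_comp_projIcc (c : C(unitInterval, E)) :
    MemLp (fun x => c (Set.projIcc 0 1 zero_le_one x)) 2 unitVolume :=
  MemLp.of_bound (c.continuous.comp continuous_projIcc).aestronglyMeasurable ‖c‖
    (Eventually.of_forall fun _ => c.norm_coe_le_norm _)

variable [NormedSpace ℂ E]

/-- The inclusion `C([0, 1]; E) → L²([0, 1]; E)`. -/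
noncomputable def toL2 : C(unitInterval, E) →L[ℂ] Lp E 2 unitVolume :=
  LinearMap.mkContinuous
    { toFun := fun c => (memLp_comp_projIcc c).toLp
      map_add' := fun _ _ => rfl
      map_smul' := fun _ _ => rfl } 1 fun c => by
    have hae : ∀ᵐ x ∂unitVolume, ‖(memLp_comp_projIcc c).toLp _ x‖ ≤ ‖c‖ := by
      filter_upwards [(memLp_comp_projIcc c).coeFn_toLp] with x hx
      exact hx ▸ c.norm_coe_le_norm _
    exact (Lp.norm_le_of_ae_bound (norm_nonneg c) hae).trans_eq (by simp [measureUnivNNReal])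

theorem coeFn_toL2 (c : C(unitInterval, E)) :
    toL2 c =ᵐ[unitVolume] fun x => c (Set.projIcc 0 1 zero_le_one x) :=
  (memLp_comp_projIcc c).coeFn_toLp

theorem norm_toL2_le (c : C(unitInterval, E)) : ‖toL2 c‖ ≤ ‖c‖ :=
  (ContinuousLinearMap.le_of_opNorm_le _
    (LinearMap.mkContinuous_norm_le _ zero_le_one _) c).trans_eq (one_mul _)

theorem toL2_injective : Function.Injective (toL2 : C(unitInterval, E) → Lp E 2 unitVolume) := by
  intro c d hcd
  have hae : (fun x => c (Set.projIcc 0 1 zero_le_one x)) =ᵐ[unitVolume]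
      fun x => d (Set.projIcc 0 1 zero_le_one x) :=
    (coeFn_toL2 c).symm.trans (hcd ▸ coeFn_toL2 d)
  have heq := Measure.eqOn_Icc_of_ae_eq volume zero_ne_one hae
    (c.continuous.comp continuous_projIcc).continuousOn
    (d.continuous.comp continuous_projIcc).continuousOn
  ext t
  simpa using heq t.2

/-- The integration operator `f ↦ ∫₀ᵗ f` from `L²([0, 1]; E)` to `C([0, 1]; E)`. -/
noncomputable def volterra : Lp E 2 unitVolume →L[ℂ] C(unitInterval, E) :=
  LinearMap.mkContinuous
    { toFun := fun f => ⟨fun t => ∫ x in (0 : ℝ)..t, f x,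
        continuous_integral_unitInterval (integrable_of_L2 f)⟩
      map_add' := fun f g => by
        ext t
        have hi (h : Lp E 2 unitVolume) : IntervalIntegrable h volume 0 t :=
          intervalIntegrable_of_mem_unitInterval (integrable_of_L2 h) unitInterval.zero_mem t.2
        exact (integral_congr_of_mem_unitInterval (Lp.coeFn_add f g) unitInterval.zero_mem
          t.2).trans (intervalIntegral.integral_add (hi f) (hi g))
      map_smul' := fun a f => by
        ext t
        exact (integral_congr_of_mem_unitInterval (Lp.coeFn_smul a f) unitInterval.zero_mem
          t.2).trans (intervalIntegral.integral_smul a _) } 1 fun f => by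
    refine (ContinuousMap.norm_le _ (by positivity)).2 fun t => ?_
    refine (norm_intervalIntegral_le_sqrt_mul f unitInterval.zero_mem t.2).trans ?_
    gcongr
    rw [sub_zero, abs_of_nonneg t.2.1]
    exact Real.sqrt_le_one.2 t.2.2

@[simp]
theorem volterra_apply (f : Lp E 2 unitVolume) (t : unitInterval) :
    volterra f t = ∫ x in (0 : ℝ)..t, f x :=
  rfl

end ContinuousRepresentatives

section SolutionOperators

variable {E : Type*} [NormedAddCommGroup E] [NormedSpace ℂ E]

/-- `y` is an absolutely continuous solution of `y' = B (f + P y)` on `[0, 1]`, written as an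
integral equation between arbitrary pairs of points. -/
def IsSolution (B : E →L[ℂ] E) (P : ℝ → E →L[ℂ] E) (f : Lp E 2 unitVolume)
    (y : C(unitInterval, E)) : Prop :=
  ∀ s t, y t - y s = B ((∫ x in (s : ℝ)..t, f x) +
    ∫ x in (s : ℝ)..t, P x (y (Set.projIcc 0 1 zero_le_one x)))

variable {B : E →L[ℂ] E} {P : ℝ → E →L[ℂ] E}

theorem integrable_apply_projIcc (hP : Integrable P unitVolume) (y : C(unitInterval, E)) :
    Integrable (fun x => P x (y (Set.projIcc 0 1 zero_le_one x))) unitVolume :=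
  (ContinuousLinearMap.apply ℂ E).flip.integrable_of_bilin_of_bdd_right ‖y‖ hP
    (memLp_comp_projIcc y).1 (Eventually.of_forall fun _ => y.norm_coe_le_norm _)

theorem norm_integral_apply_projIcc_le (hP : Integrable P unitVolume) (y : C(unitInterval, E))
    (s t : unitInterval) :
    ‖∫ x in (s : ℝ)..t, P x (y (Set.projIcc 0 1 zero_le_one x))‖ ≤
      |∫ x in (s : ℝ)..t, ‖P x‖| * ‖y‖ := by
  rw [← abs_norm y, ← abs_mul, ← intervalIntegral.integral_mul_const]
  refine intervalIntegral.norm_integral_le_abs_of_norm_le (Eventually.of_forall fun x => ?_)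
    ((intervalIntegrable_of_mem_unitInterval hP s.2 t.2).norm.mul_const _)
  exact (P x).le_opNorm_of_le (y.norm_coe_le_norm _)

theorem exists_isSolution [CompleteSpace E] (hP : Integrable P unitVolume)
    {f : Lp E 2 unitVolume} {y y' : ℝ → E} (hy : AbsolutelyContinuousOnInterval y 0 1)
    (hy' : Integrable y' unitVolume) (hder : ∀ᵐ x ∂unitVolume, HasDerivAt y (y' x) x)
    (heq : y' =ᵐ[unitVolume] fun x => B (f x + P x (y x))) :
    ∃ c : C(unitInterval, E), y =ᵐ[unitVolume] toL2 c ∧ IsSolution B P f c := by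
  have hcont : ContinuousOn y (Set.Icc 0 1) := by simpa using hy.continuousOn
  let c : C(unitInterval, E) := ⟨_, hcont.domRestrict⟩
  have hc {x : ℝ} (hx : x ∈ Set.Icc (0 : ℝ) 1) : c (Set.projIcc 0 1 zero_le_one x) = y x := by
    rw [Set.projIcc_of_mem _ hx]
    rfl
  have hPc : (fun x => P x (c (Set.projIcc 0 1 zero_le_one x))) =ᵐ[unitVolume]
      fun x => P x (y x) := by
    filter_upwards [ae_restrict_mem measurableSet_Icc] with x hx
    rw [hc hx]
  refine ⟨c, ?_, fun s t => ?_⟩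
  · filter_upwards [coeFn_toL2 c, ae_restrict_mem measurableSet_Icc] with x hx hx'
    rw [hx, hc hx']
  have hftc (t : unitInterval) : y t = y 0 + ∫ x in (0 : ℝ)..t, y' x := by
    refine eq_add_integral_of_ae_hasDerivAt hy
      (intervalIntegrable_of_mem_unitInterval hy' unitInterval.zero_mem unitInterval.one_mem) ?_
      (Set.Icc_subset_uIcc t.2)
    rw [Set.uIcc_of_le zero_le_one]
    exact (ae_restrict_iff' measurableSet_Icc).1 hder
  have hPi := intervalIntegrable_of_mem_unitInterval (integrable_apply_projIcc hP c) s.2 t.2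
  have hfi := intervalIntegrable_of_mem_unitInterval (integrable_of_L2 f) s.2 t.2
  calc c t - c s = ∫ x in (s : ℝ)..t, y' x := by
        rw [← integral_sub_integral_of_mem_unitInterval hy' s.2 t.2,
          ← add_sub_add_left_eq_sub (∫ x in (0 : ℝ)..t, y' x) _ (y 0), ← hftc, ← hftc]
        rfl
    _ = ∫ x in (s : ℝ)..t, B (f x + P x (c (Set.projIcc 0 1 zero_le_one x))) :=
        integral_congr_of_mem_unitInterval (heq.trans (by
          filter_upwards [hPc] with x hx
          rw [hx])) s.2 t.2
    _ = _ := by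
        rw [← intervalIntegral.integral_add hfi hPi]
        exact B.intervalIntegral_comp_comm (hfi.add hPi)

theorem exists_linearMap_isSolution {R : Lp E 2 unitVolume →L[ℂ] Lp E 2 unitVolume}
    (hR : ∀ f, ∃ c, R f = toL2 c ∧ IsSolution B P f c) :
    ∃ Y : Lp E 2 unitVolume →ₗ[ℂ] C(unitInterval, E),
      ∀ f, R f = toL2 (Y f) ∧ IsSolution B P f (Y f) := by
  obtain ⟨ψ, hψ⟩ := LinearMap.exists_leftInverse_of_injective (toL2 (E := E)).toLinearMap
    (LinearMap.ker_eq_bot.2 toL2_injective)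
  refine ⟨ψ ∘ₗ R, fun f => ?_⟩
  obtain ⟨c, hc, hsol⟩ := hR f
  have hψc : ψ (R f) = c := by
    rw [hc]
    exact LinearMap.congr_fun hψ c
  exact hψc.symm ▸ ⟨hc, hsol⟩

end SolutionOperators

section LeadingTerm

variable {E : Type*} [NormedAddCommGroup E] [NormedSpace ℂ E]

/-- The operator `f ↦ B ∫₀ˣ f` in `L²([0, 1]; E)`: the leading term of the resolvent. -/
noncomputable def leadingTerm (B : E →L[ℂ] E) : Lp E 2 unitVolume →L[ℂ] Lp E 2 unitVolume :=
  toL2 ∘L B.compLeftContinuous ℂ unitInterval ∘L volterra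

variable {B : E →L[ℂ] E} {P : ℝ → E →L[ℂ] E} {R : Lp E 2 unitVolume →L[ℂ] Lp E 2 unitVolume}

theorem leadingTerm_eq_toL2 (B : E →L[ℂ] E) (f : Lp E 2 unitVolume) :
    leadingTerm B f = toL2 (B.compLeftContinuous ℂ unitInterval (volterra f)) :=
  rfl

theorem exists_continuous_monotone_abs_le {g : ℝ → ℝ} (hg : Integrable g unitVolume)
    (hg₀ : ∀ x, 0 ≤ g x) : ∃ W : unitInterval → ℝ, Continuous W ∧ Monotone W ∧
      ∀ s t : unitInterval,
        |(t : ℝ) - s| ≤ |W t - W s| ∧ |∫ x in (s : ℝ)..t, g x| ≤ |W t - W s| := by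
  have hnonneg {s t : unitInterval} (hst : s ≤ t) : 0 ≤ ∫ x in (s : ℝ)..t, g x :=
    intervalIntegral.integral_nonneg hst fun x _ => hg₀ x
  refine ⟨fun t => t + ∫ x in (0 : ℝ)..t, g x,
    continuous_subtype_val.add (continuous_integral_unitInterval hg), fun s t hst => ?_,
    fun s t => ?_⟩
  · have := hnonneg hst
    rw [← integral_sub_integral_of_mem_unitInterval hg s.2 t.2, sub_nonneg] at this
    exact add_le_add hst this
  · have habs : |(t : ℝ) - s + ∫ x in (s : ℝ)..t, g x| =
        |(t : ℝ) - s| + |∫ x in (s : ℝ)..t, g x| := by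
      refine (abs_add_eq_add_abs_iff _ _).2 ?_
      rcases le_total s t with hst | hst
      · exact .inl ⟨sub_nonneg.2 hst, hnonneg hst⟩
      · rw [intervalIntegral.integral_symm]
        exact .inr ⟨sub_nonpos.2 hst, neg_nonpos.2 (hnonneg hst)⟩
    rw [add_sub_add_comm, integral_sub_integral_of_mem_unitInterval hg s.2 t.2, habs]
    exact ⟨le_add_of_nonneg_right (abs_nonneg _), le_add_of_nonneg_left (abs_nonneg _)⟩

theorem exists_gelfandLE_sub_leadingTerm [FiniteDimensional ℂ E] (hP : Integrable P unitVolume)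
    (hR : ∀ f, ∃ c, R f = toL2 c ∧ IsSolution B P f c) :
    ∃ β M : ℝ, 0 ≤ M ∧ ∀ k : ℕ, k ≠ 0 → β * (M / k) ≤ 1 / 2 →
      GelfandLE (R - leadingTerm B).toLinearMap (2 * ((k + 1) * Module.finrank ℂ E))
        (2 * β ^ 2 * (M / k * √(M / k))) := by
  obtain ⟨Y, hY⟩ := exists_linearMap_isSolution hR
  obtain ⟨W, hW, hWmono, hWabs⟩ :=
    exists_continuous_monotone_abs_le hP.norm fun x => norm_nonneg (P x)
  let Z : Lp E 2 unitVolume →ₗ[ℂ] C(unitInterval, E) :=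
    Y - (B.compLeftContinuous ℂ unitInterval ∘L volterra).toLinearMap
  have hRZ (f) : (R - leadingTerm B) f = toL2 (Z f) := by
    rw [sub_apply, (hY f).1, leadingTerm_eq_toL2, ← map_sub]
    rfl
  have hPY (f) (s t : unitInterval) :
      ‖∫ x in (s : ℝ)..t, P x (Y f (Set.projIcc 0 1 zero_le_one x))‖ ≤ |W t - W s| * ‖Y f‖ :=
    (norm_integral_apply_projIcc_le hP _ s t).trans
      (mul_le_mul_of_nonneg_right (hWabs s t).2 (norm_nonneg _))
  have hZsub (f) (s t : unitInterval) : Z f t - Z f s =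
      B (∫ x in (s : ℝ)..t, P x (Y f (Set.projIcc 0 1 zero_le_one x))) := by
    have hY_sub := (hY f).2 s t
    rw [map_add, ← integral_sub_integral_of_mem_unitInterval (integrable_of_L2 f) s.2 t.2,
      map_sub, add_comm, ← sub_eq_iff_eq_add, sub_sub_sub_comm] at hY_sub
    exact hY_sub
  refine ⟨‖B‖, W 1 - W 0, sub_nonneg.2 (hWmono unitInterval.nonneg'), fun k hk hβ => ?_⟩
  refine (gelfandLE_of_norm_sub_le (Y := Y) (Z := Z) hW
    (fun t => ⟨hWmono unitInterval.nonneg', hWmono unitInterval.le_one'⟩) (norm_nonneg B)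
    (fun f t s => ?_) (fun f t s => hZsub f s t ▸ B.le_opNorm_of_le (hPY f s t))
    hk le_rfl hβ).of_norm_le fun f => ?_
  · rw [(hY f).2 s t]
    refine B.le_opNorm_of_le ((norm_add_le _ _).trans (add_le_add ?_ (hPY f s t)))
    exact (norm_intervalIntegral_le_sqrt_mul f s.2 t.2).trans
      (mul_le_mul_of_nonneg_right (Real.sqrt_le_sqrt (hWabs s t).1) (norm_nonneg _))
  · exact (congrArg _ (hRZ f)).trans_le (norm_toL2_le _)

end LeadingTerm

section LeadingTermHilbert

variable {E : Type*} [NormedAddCommGroup E] [InnerProductSpace ℂ E] [FiniteDimensional ℂ E]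
  {B : E →L[ℂ] E} {P : ℝ → E →L[ℂ] E} {R : Lp E 2 unitVolume →L[ℂ] Lp E 2 unitVolume}

theorem exists_eventually_gelfandLE_sub_leadingTerm (hP : Integrable P unitVolume)
    (hR : ∀ f, ∃ c, R f = toL2 c ∧ IsSolution B P f c) :
    ∃ u : ℕ → ℝ, (∀ k, 0 ≤ u k) ∧ Tendsto (fun k : ℕ => k * u k) atTop (𝓝 0) ∧
      ∀ᶠ k in atTop, GelfandLE (R - leadingTerm B).toLinearMap
        (4 * (Module.finrank ℂ E + 1) * k) (u k) := by
  obtain ⟨β, M, hM, hgelfand⟩ := exists_gelfandLE_sub_leadingTerm hP hR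
  have hMk : Tendsto (fun k : ℕ => M / k) atTop (𝓝 0) := tendsto_const_div_atTop_nhds_zero_nat M
  refine ⟨fun k => 2 * β ^ 2 * (M / k * √(M / k)), fun k => by positivity, ?_, ?_⟩
  · have hlim := (hMk.sqrt).const_mul (2 * β ^ 2 * M)
    rw [Real.sqrt_zero, mul_zero] at hlim
    refine hlim.congr' ?_
    filter_upwards [eventually_ne_atTop 0] with k hk
    field_simp
  · have hβ := hMk.const_mul β
    rw [mul_zero] at hβ
    filter_upwards [hβ.eventually (ge_mem_nhds (one_half_pos (α := ℝ))), eventually_ge_atTop 1]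
      with k hk hk₁
    refine (hgelfand k (Nat.one_le_iff_ne_zero.1 hk₁) hk).mono ?_ le_rfl
    nlinarith [Nat.mul_le_mul_left (Module.finrank ℂ E) hk₁]

theorem isCompactOperator_sub_leadingTerm (hP : Integrable P unitVolume)
    (hR : ∀ f, ∃ c, R f = toL2 c ∧ IsSolution B P f c) : IsCompactOperator (R - leadingTerm B) := by
  obtain ⟨u, hu₀, hu, hT⟩ := exists_eventually_gelfandLE_sub_leadingTerm hP hR
  refine isCompactOperator_of_gelfandLE fun ε hε => ?_
  obtain ⟨k, hk, huk, hk₁⟩ := (hT.and ((hu.eventually (gt_mem_nhds hε)).and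
    (eventually_ge_atTop 1))).exists
  have huε : u k ≤ ε :=
    (le_mul_of_one_le_left (hu₀ k) (Nat.one_le_cast.2 hk₁)).trans huk.le
  exact ⟨_, hk.mono le_rfl huε⟩

theorem tendsto_succ_mul_singularValue_sub_leadingTerm (hP : Integrable P unitVolume)
    (hR : ∀ f, ∃ c, R f = toL2 c ∧ IsSolution B P f c) :
    Tendsto (fun N : ℕ => ((N : ℝ) + 1) * singularValue (R - leadingTerm B) N) atTop (𝓝 0) := by
  obtain ⟨u, hu₀, hu, hT⟩ := exists_eventually_gelfandLE_sub_leadingTerm hP hR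
  exact tendsto_succ_mul_singularValue_of_gelfandLE (by positivity) hu₀ hu hT

end LeadingTermHilbert

section ResolventEquation

variable {ι : Type*} [Fintype ι] [DecidableEq ι]
  {n : ℕ} {b : Fin n → ℂ} {C D : Matrix (Fin n) (Fin n) ℂ}
  {Q : ℝ → Matrix (Fin n) (Fin n) ℂ} {z : ℂ} {R : L2 n →L[ℂ] L2 n}

/-- The operator `i B = diag(i b₁, …, i bₙ)` on `ℂⁿ`. -/
noncomputable def iDiag (b : ι → ℂ) : EuclideanSpace ℂ ι →L[ℂ] EuclideanSpace ℂ ι :=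
  Matrix.toEuclideanCLM (n := ι) (𝕜 := ℂ) (Matrix.diagonal fun j => Complex.I * b j)

/-- The potential `z - Q` of the equation `y' = i B (f + (z - Q) y)` solved by the resolvent. -/
noncomputable def shiftedPotential (Q : ℝ → Matrix (Fin n) (Fin n) ℂ) (z : ℂ) (x : ℝ) :
    EuclideanSpace ℂ (Fin n) →L[ℂ] EuclideanSpace ℂ (Fin n) :=
  Matrix.toEuclideanCLM (n := Fin n) (𝕜 := ℂ) (z • 1 - Q x)

theorem iDiag_apply (b : ι → ℂ) (v : EuclideanSpace ℂ ι) (j : ι) :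
    iDiag b v j = Complex.I * b j * v j := by
  rw [iDiag, Matrix.ofLp_toEuclideanCLM, Matrix.mulVec_diagonal]

theorem shiftedPotential_apply (Q : ℝ → Matrix (Fin n) (Fin n) ℂ) (z : ℂ) (x : ℝ)
    (v : EuclideanSpace ℂ (Fin n)) (j : Fin n) :
    shiftedPotential Q z x v j = z * v j - (Q x).mulVec v.ofLp j := by
  rw [shiftedPotential, Matrix.ofLp_toEuclideanCLM, Matrix.sub_mulVec, Matrix.smul_mulVec,
    Matrix.one_mulVec]
  rfl

theorem integrable_shiftedPotential
    (hQ : ∀ j k, IntegrableOn (fun x => Q x j k) (Set.Icc (0 : ℝ) 1)) (z : ℂ) :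
    Integrable (shiftedPotential Q z) unitVolume := by
  let L : (Fin n → Fin n → ℂ) →L[ℂ] EuclideanSpace ℂ (Fin n) →L[ℂ] EuclideanSpace ℂ (Fin n) :=
    ((Matrix.toEuclideanCLM (n := Fin n) (𝕜 := ℂ)).toAlgEquiv.toLinearMap ∘ₗ
      (Matrix.ofLinearEquiv ℂ).toLinearMap).toContinuousLinearMap
  have hentries : Integrable (fun x j k => (z • (1 : Matrix (Fin n) (Fin n) ℂ) - Q x) j k)
      unitVolume :=
    .of_eval fun j => .of_eval fun k => (integrable_const _).sub (hQ j k)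
  exact L.integrable_comp hentries

theorem eq_iDiag_of_diffExpr_eq (hb : ∀ j, b j ≠ 0) {y y' : ℝ → EuclideanSpace ℂ (Fin n)} {x : ℝ}
    {v : EuclideanSpace ℂ (Fin n)} (h : v + z • y x = diffExpr b Q y y' x) :
    y' x = iDiag b (v + shiftedPotential Q z x (y x)) := by
  have hinv : (Matrix.diagonal b)⁻¹ = Matrix.diagonal fun j => (b j)⁻¹ := by
    refine Matrix.inv_eq_right_inv ?_
    rw [Matrix.diagonal_mul_diagonal, ← Matrix.diagonal_one]
    exact congrArg _ (funext fun j => mul_inv_cancel₀ (hb j))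
  ext j
  have hj : v j + z * y x j = -Complex.I * ((b j)⁻¹ * y' x j) + (Q x).mulVec (y x).ofLp j := by
    have hj := congrArg (fun w : EuclideanSpace ℂ (Fin n) => w j) h
    simpa only [diffExpr, hinv, Matrix.mulVec_diagonal, PiLp.add_apply, PiLp.smul_apply,
      Pi.add_apply, Pi.smul_apply, smul_eq_mul] using hj
  rw [iDiag_apply, PiLp.add_apply, shiftedPotential_apply]
  calc y' x j = -(Complex.I * Complex.I) * (b j * (b j)⁻¹) * y' x j := by
        rw [Complex.I_mul_I, mul_inv_cancel₀ (hb j)]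
        ring
    _ = Complex.I * b j * (v j + (z * y x j - (Q x).mulVec (y x).ofLp j)) := by
        linear_combination -Complex.I * b j * hj

theorem IsResolventAt.exists_isSolution (hb : ∀ j, b j ≠ 0)
    (hQ : ∀ j k, IntegrableOn (fun x => Q x j k) (Set.Icc (0 : ℝ) 1))
    (hR : IsResolventAt (op b C D Q) z R) (f : L2 n) :
    ∃ c, R f = toL2 c ∧ IsSolution (iDiag b) (shiftedPotential Q z) f c := by
  obtain ⟨hf, hLR⟩ := hR.1 f
  have hgraph : (R f, f + z • R f) ∈ opGraph b C D Q := by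
    rw [← graph_op, ← sub_eq_iff_eq_add.1 hLR]
    exact (op b C D Q).mem_graph ⟨R f, hf⟩
  obtain ⟨y, y', hy, -, hRy, hdiff⟩ := hgraph
  have hy' : y' =ᵐ[unitVolume] fun x => iDiag b (f x + shiftedPotential Q z x (y x)) := by
    filter_upwards [hRy, hdiff, Lp.coeFn_add f (z • R f), Lp.coeFn_smul z (R f)]
      with x hRyx hdiffx hadd hsmul
    rw [hadd, Pi.add_apply, hsmul, Pi.smul_apply, hRyx] at hdiffx
    exact eq_iDiag_of_diffExpr_eq hb hdiffx
  obtain ⟨c, hyc, hc⟩ := DiracBVP.exists_isSolution (integrable_shiftedPotential hQ z) hy.absCont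
    hy.integrable hy.hasDeriv hy'
  exact ⟨c, Lp.ext (hRy.trans hyc), hc⟩

end ResolventEquation

section DiagonalOperators

variable {ι 𝕜 H : Type*} [RCLike 𝕜] [NormedAddCommGroup H] [InnerProductSpace 𝕜 H]

theorem hasSum_norm_inner_sq (e : HilbertBasis ι 𝕜 H) (f : H) :
    HasSum (fun i => ‖inner 𝕜 (e i) f‖ ^ 2) (‖f‖ ^ 2) := by
  have h := (RCLike.reCLM (K := 𝕜)).hasSum (e.hasSum_inner_mul_inner f f)
  simpa only [RCLike.reCLM_apply, inner_mul_symm_re_eq_norm, inner_self_eq_norm_sq, norm_mul,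
    norm_inner_symm f, ← sq] using h

theorem norm_le_norm_of_norm_inner_le (e : HilbertBasis ι 𝕜 H) {f g : H}
    (h : ∀ i, ‖inner 𝕜 (e i) f‖ ≤ ‖inner 𝕜 (e i) g‖) : ‖f‖ ≤ ‖g‖ :=
  (sq_le_sq₀ (norm_nonneg f) (norm_nonneg g)).1 <|
    hasSum_le (fun i => pow_le_pow_left₀ (norm_nonneg _) (h i) 2) (hasSum_norm_inner_sq e f)
      (hasSum_norm_inner_sq e g)

/-- Outside the finite set `Z` of indices, `T` is diagonal in the orthonormal basis `e`, with
diagonal entries of modulus `μ i`: this is required on the vectors without components in `Z`, whose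
images may have arbitrary components in `Z`. -/
def IsDiagonalOutside (e : HilbertBasis ι 𝕜 H) (Z : Finset ι) (μ : ι → ℝ) (T : H →ₗ[𝕜] H) : Prop :=
  ∀ f, (∀ i ∈ Z, inner 𝕜 (e i) f = 0) → ∀ i ∉ Z, ‖inner 𝕜 (e i) (T f)‖ = μ i * ‖inner 𝕜 (e i) f‖

variable {e : HilbertBasis ι 𝕜 H} {Z S : Finset ι} {μ : ι → ℝ} {T : H →ₗ[𝕜] H} {t : ℝ}

theorem IsDiagonalOutside.gelfandLE (hT : IsDiagonalOutside e Z μ T) (ht : 0 ≤ t)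
    (hS : ∀ i ∉ Z, i ∉ S → μ i ≤ t) : GelfandLE T (Z.card + S.card + Z.card) t := by
  let coeff (i : ι) : H →ₗ[𝕜] 𝕜 := (innerSL 𝕜 (e i)).toLinearMap
  let Λ : H →ₗ[𝕜] (Z → 𝕜) × (S → 𝕜) × (Z → 𝕜) :=
    (LinearMap.pi fun i : Z => coeff i).prod
      ((LinearMap.pi fun i : S => coeff i).prod (LinearMap.pi fun i : Z => coeff i ∘ₗ T))
  refine gelfandLE_of_ker (by simp [add_assoc]) Λ fun f hf => ?_
  obtain ⟨hfZ, hf'⟩ := Prod.mk.inj hf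
  obtain ⟨hfS, hTf⟩ := Prod.mk.inj hf'
  have hfZ (i) (hi : i ∈ Z) : inner 𝕜 (e i) f = 0 := congrFun hfZ ⟨i, hi⟩
  have hfS (i) (hi : i ∈ S) : inner 𝕜 (e i) f = 0 := congrFun hfS ⟨i, hi⟩
  have hTf (i) (hi : i ∈ Z) : inner 𝕜 (e i) (T f) = 0 := congrFun hTf ⟨i, hi⟩
  have htf : ‖(t : 𝕜) • f‖ = t * ‖f‖ := by rw [norm_smul, RCLike.norm_of_nonneg ht]
  rw [← htf]
  refine norm_le_norm_of_norm_inner_le e fun i => ?_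
  rw [inner_smul_right, norm_mul, RCLike.norm_of_nonneg ht]
  by_cases hiZ : i ∈ Z
  · rw [hTf i hiZ, norm_zero]
    positivity
  rw [hT f hfZ i hiZ]
  by_cases hiS : i ∈ S
  · rw [hfS i hiS, norm_zero, mul_zero, mul_zero]
  · exact mul_le_mul_of_nonneg_right (hS i hiZ hiS) (norm_nonneg _)

theorem IsDiagonalOutside.le_norm (hT : IsDiagonalOutside e Z μ T) (ht : 0 ≤ t)
    (hSZ : Disjoint S Z) (hS : ∀ i ∈ S, t ≤ μ i) {f : H}
    (hf : f ∈ Submodule.span 𝕜 (Set.range fun i : S => e i)) : t * ‖f‖ ≤ ‖T f‖ := by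
  have hf0 (i) (hi : i ∉ S) : inner 𝕜 (e i) f = 0 := by
    induction hf using Submodule.span_induction with
    | mem x hx =>
      obtain ⟨j, rfl⟩ := hx
      exact e.orthonormal.2 fun hij => hi (hij ▸ j.2)
    | zero => exact inner_zero_right _
    | add x y _ _ hx hy => rw [inner_add_right, hx, hy, add_zero]
    | smul a x _ hx => rw [inner_smul_right, hx, mul_zero]
  have htf : ‖(t : 𝕜) • f‖ = t * ‖f‖ := by rw [norm_smul, RCLike.norm_of_nonneg ht]
  rw [← htf]
  refine norm_le_norm_of_norm_inner_le e fun i => ?_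
  rw [inner_smul_right, norm_mul, RCLike.norm_of_nonneg ht]
  by_cases hi : i ∈ S
  · rw [hT f (fun j hj => hf0 j (Finset.disjoint_right.1 hSZ hj)) i (Finset.disjoint_left.1 hSZ hi)]
    exact mul_le_mul_of_nonneg_right (hS i hi) (norm_nonneg _)
  · rw [hf0 i hi, norm_zero, mul_zero]
    exact norm_nonneg _

theorem IsDiagonalOutside.le_singularValue {H : Type*} [NormedAddCommGroup H]
    [InnerProductSpace ℂ H] [CompleteSpace H] {e : HilbertBasis ι ℂ H} {T : H →L[ℂ] H}
    (hT : IsDiagonalOutside e Z μ T.toLinearMap) (hcomp : IsCompactOperator T) (ht : 0 ≤ t)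
    (hSZ : Disjoint S Z) (hS : ∀ i ∈ S, t ≤ μ i) {k : ℕ} (hk : k < S.card) :
    t ≤ singularValue T k := by
  refine DiracBVP.le_singularValue hcomp (Submodule.span ℂ (Set.range fun i : S => e i)) ?_
    fun f hf => hT.le_norm ht hSZ hS hf
  have he : LinearIndependent ℂ fun i : S => e i :=
    e.orthonormal.linearIndependent.comp _ Subtype.val_injective
  have := FiniteDimensional.span_of_finite ℂ (Set.finite_range fun i : S => e i)
  rw [← Module.finrank_eq_rank, finrank_span_eq_card he, Fintype.card_coe]
  exact_mod_cast hk

end DiagonalOperators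

section FourierCoefficients

theorem integral_mul_eq_of_ae_hasDerivAt {𝕜 : Type*} [RCLike 𝕜] {u v u' v' : ℝ → 𝕜} {a b : ℝ}
    (hu : AbsolutelyContinuousOnInterval u a b) (hv : AbsolutelyContinuousOnInterval v a b)
    (hu' : IntervalIntegrable u' volume a b) (hv' : IntervalIntegrable v' volume a b)
    (hud : ∀ᵐ x, x ∈ Set.uIcc a b → HasDerivAt u (u' x) x)
    (hvd : ∀ᵐ x, x ∈ Set.uIcc a b → HasDerivAt v (v' x) x) :
    ∫ x in a..b, u x * v' x = u b * v b - u a * v a - ∫ x in a..b, u' x * v x := by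
  have hu'v := hu'.mul_continuousOn hv.continuousOn
  have huv' := hv'.continuousOn_mul hu.continuousOn
  have hftc := eq_add_integral_of_ae_hasDerivAt (hu.smul hv) (hu'v.add huv')
    (by filter_upwards [hud, hvd] with x hux hvx hx using (hux hx).mul (hvx hx))
    Set.right_mem_uIcc
  rw [intervalIntegral.integral_add hu'v huv'] at hftc
  simp only [Pi.smul_apply', smul_eq_mul] at hftc
  linear_combination -hftc

variable {a b : ℝ} {f f' : ℝ → ℂ}

theorem fourierCoeffOn_of_ae_hasDerivAt (hab : a < b) {k : ℤ} (hk : k ≠ 0)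
    (hf : AbsolutelyContinuousOnInterval f a b) (hf' : IntervalIntegrable f' volume a b)
    (hd : ∀ᵐ x, x ∈ Set.uIcc a b → HasDerivAt f (f' x) x) :
    fourierCoeffOn hab f k = 1 / (-2 * Real.pi * Complex.I * k) *
      (fourier (-k) (a : AddCircle (b - a)) * (f b - f a) - (b - a) * fourierCoeffOn hab f' k) := by
  have hT : ((b - a : ℝ) : ℂ) ≠ 0 := by exact_mod_cast (sub_pos.2 hab).ne'
  have hper : (b : AddCircle (b - a)) = a := by simpa using AddCircle.coe_add_period (b - a) a
  let u (x : ℝ) : ℂ := fourier (-k) (x : AddCircle (b - a))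
  have hud (x : ℝ) : HasDerivAt u (-2 * Real.pi * Complex.I * k / (b - a : ℝ) * u x) x :=
    hasDerivAt_fourier_neg (b - a) k x
  have hu : ContDiff ℝ 1 u := by
    simp only [u, fourier_coe_apply]
    exact ((contDiff_const.mul Complex.ofRealCLM.contDiff).div_const _).cexp
  have hparts := integral_mul_eq_of_ae_hasDerivAt hu.contDiffOn.absolutelyContinuousOnInterval hf
    ((hu.continuous.const_mul _).intervalIntegrable _ _) hf'
    (Eventually.of_forall fun x _ => hud x) hd
  simp only [mul_assoc _ (u _), intervalIntegral.integral_const_mul] at hparts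
  simp only [fourierCoeffOn_eq_integral, smul_eq_mul, Complex.real_smul]
  change _ = _ * (u a * _ - _ * (_ * ∫ x in a..b, u x * f' x))
  rw [hparts, show u b = u a by simp only [u, hper]]
  have := Real.pi_ne_zero
  push_cast at hT ⊢
  field_simp
  ring

theorem fourierCoeffOn_integral (hab : a < b) (hf : IntervalIntegrable f volume a b)
    (h0 : fourierCoeffOn hab f 0 = 0) {k : ℤ} (hk : k ≠ 0) :
    fourierCoeffOn hab (fun x => ∫ y in a..x, f y) k =
      (b - a) / (2 * Real.pi * Complex.I * k) * fourierCoeffOn hab f k := by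
  have hf_int : ∫ y in a..b, f y = 0 := by
    have hab' : (b : ℂ) - a ≠ 0 := by exact_mod_cast (sub_pos.2 hab).ne'
    simpa [fourierCoeffOn_eq_integral, hab'] using h0
  rw [fourierCoeffOn_of_ae_hasDerivAt hab hk (absolutelyContinuousOnInterval_integral hf) hf
    (hf.ae_hasDerivAt_integral.mono fun x hx hxI => hx hxI a Set.left_mem_uIcc), hf_int,
    intervalIntegral.integral_same]
  have := Real.pi_ne_zero
  field_simp
  ring

theorem fourierCoeffOn_fourier (hab : a < b) (k l : ℤ) :
    fourierCoeffOn hab (fun x => fourier l (x : AddCircle (b - a))) k =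
      (Pi.single l 1 : ℤ → ℂ) k := by
  have : Fact (0 < b - a) := ⟨sub_pos.2 hab⟩
  rw [← fourierCoeff_fourier (T := b - a), fourierCoeff_eq_intervalIntegral _ _ a,
    fourierCoeffOn_eq_integral, add_sub_cancel]

end FourierCoefficients

section FourierBasis

variable {ι : Type*} [Fintype ι]

theorem inner_toL2 (c : C(unitInterval, EuclideanSpace ℂ ι))
    (f : Lp (EuclideanSpace ℂ ι) 2 unitVolume) :
    inner ℂ (toL2 c) f =
      ∫ x in (0 : ℝ)..1, inner ℂ (c (Set.projIcc 0 1 zero_le_one x)) (f x) := by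
  rw [L2.inner_def, intervalIntegral.integral_of_le zero_le_one, ← integral_Icc_eq_integral_Ioc]
  refine integral_congr_ae ?_
  filter_upwards [coeFn_toL2 c] with x hx
  rw [hx]

theorem memLp_coord (f : Lp (EuclideanSpace ℂ ι) 2 unitVolume) (j : ι) :
    MemLp (fun x => f x j) 2 unitVolume :=
  (EuclideanSpace.proj (𝕜 := ℂ) j).comp_memLp' (Lp.memLp f)

theorem eq_zero_of_fourierCoeffOn_eq_zero (f : Lp (EuclideanSpace ℂ ι) 2 unitVolume)
    (h : ∀ j k, fourierCoeffOn zero_lt_one (fun x => f x j) k = 0) : f = 0 := by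
  have hcoord (j : ι) : (fun x => f x j) =ᵐ[unitVolume] 0 := by
    have hsum := hasSum_sq_fourierCoeffOn zero_lt_one (f := fun x => f x j)
      (by rw [restrict_Ioc_eq_restrict_Icc]; exact memLp_coord f j)
    simp only [h, norm_zero, ne_eq, OfNat.ofNat_ne_zero, not_false_eq_true, zero_pow, sub_zero,
      inv_one, one_smul] at hsum
    have hf_int : ∫ x, ‖f x j‖ ^ 2 ∂unitVolume = 0 := by
      rw [integral_Icc_eq_integral_Ioc, ← intervalIntegral.integral_of_le zero_le_one]
      exact hsum.unique hasSum_zero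
    have hzero := (integral_eq_zero_iff_of_nonneg (fun x => sq_nonneg ‖f x j‖)
      ((memLp_two_iff_integrable_sq_norm (memLp_coord f j).1).1 (memLp_coord f j))).1 hf_int
    exact hzero.mono fun x hx => norm_eq_zero.1 (pow_eq_zero_iff two_ne_zero |>.1 hx)
  refine Lp.ext ?_
  filter_upwards [ae_all_iff.2 hcoord, Lp.coeFn_zero (EuclideanSpace ℂ ι) 2 unitVolume]
    with x hx hx0
  rw [hx0]
  ext j
  exact hx j

theorem fourierCoeffOn_toL2 (c : C(unitInterval, EuclideanSpace ℂ ι)) (j : ι) {g : ℝ → ℂ}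
    (hg : ∀ t : unitInterval, c t j = g t) :
    fourierCoeffOn zero_lt_one (fun x => toL2 c x j) = fourierCoeffOn zero_lt_one g := by
  refine fourierCoeffOn_congr_ae zero_lt_one ?_
  rw [restrict_Ioc_eq_restrict_Icc]
  filter_upwards [coeFn_toL2 c, ae_restrict_mem measurableSet_Icc] with x hx hxI
  rw [hx, hg, Set.projIcc_of_mem _ hxI]

variable [DecidableEq ι]

/-- The vector-valued exponential `x ↦ exp (2πikx) eⱼ`, where `q = (j, k)`. -/
noncomputable def fourierMode (q : ι × ℤ) : C(unitInterval, EuclideanSpace ℂ ι) where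
  toFun t := fourier q.2 ((t : ℝ) : AddCircle (1 - 0 : ℝ)) • EuclideanSpace.single q.1 1
  continuous_toFun := by
    have := AddCircle.continuous_mk' (1 - 0 : ℝ)
    fun_prop

theorem inner_fourierMode (q : ι × ℤ) (f : Lp (EuclideanSpace ℂ ι) 2 unitVolume) :
    inner ℂ (toL2 (fourierMode q)) f = fourierCoeffOn zero_lt_one (fun x => f x q.1) q.2 := by
  rw [inner_toL2, fourierCoeffOn_eq_integral, show (1 : ℝ) / (1 - 0) = 1 by norm_num, one_smul]
  refine intervalIntegral.integral_congr fun x hx => ?_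
  rw [Set.uIcc_of_le zero_le_one] at hx
  simp only [fourierMode, ContinuousMap.coe_mk, Set.projIcc_of_mem _ hx, inner_smul_left,
    EuclideanSpace.inner_single_left, map_one, one_mul, fourier_neg, smul_eq_mul]

theorem orthonormal_fourierMode :
    Orthonormal ℂ fun q : ι × ℤ => toL2 (fourierMode q) := by
  rw [orthonormal_iff_ite]
  rintro ⟨j, k⟩ ⟨j', k'⟩
  have hcoeff := fourierCoeffOn_toL2 (fourierMode (j', k')) j
    (g := fun x => (if j = j' then 1 else 0) * fourier k' (x : AddCircle (1 - 0 : ℝ)))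
    fun t => by simp [fourierMode]
  rw [inner_fourierMode, hcoeff, fourierCoeffOn.const_mul, fourierCoeffOn_fourier]
  simp only [Pi.single_apply, ite_mul, one_mul, zero_mul, Prod.mk.injEq, ite_and]

/-- The orthonormal basis of `L²([0, 1]; ℂⁿ)` formed by the vector-valued exponentials. -/
noncomputable def fourierHilbertBasis :
    HilbertBasis (ι × ℤ) ℂ (Lp (EuclideanSpace ℂ ι) 2 unitVolume) :=
  HilbertBasis.mkOfOrthogonalEqBot orthonormal_fourierMode <| by
    refine (Submodule.eq_bot_iff _).2 fun f hf => eq_zero_of_fourierCoeffOn_eq_zero f fun j k => ?_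
    rw [← inner_fourierMode (j, k) f]
    exact (Submodule.mem_orthogonal _ f).1 hf _ (Submodule.subset_span ⟨(j, k), rfl⟩)

theorem inner_fourierHilbertBasis (q : ι × ℤ) (f : Lp (EuclideanSpace ℂ ι) 2 unitVolume) :
    inner ℂ (fourierHilbertBasis q) f = fourierCoeffOn zero_lt_one (fun x => f x q.1) q.2 := by
  rw [fourierHilbertBasis, HilbertBasis.coe_mkOfOrthogonalEqBot, inner_fourierMode]

end FourierBasis

section LeadingTermSpectrum

variable {ι : Type*} [Fintype ι]

/-- The indices `(j, k)`, `k ≠ 0`, of the exponentials on which the leading term of the resolvent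
has a diagonal entry `‖b j‖ / (2π|k|)` of size at least `1 / (2πX)`. -/
noncomputable def lowModes (b : ι → ℂ) (X : ℝ) : Finset (ι × ℤ) :=
  (Finset.univ.sigma fun j => (Finset.Icc (-⌊‖b j‖ * X⌋) ⌊‖b j‖ * X⌋).erase 0).map
    (Equiv.sigmaEquivProd ι ℤ).toEmbedding

theorem mem_lowModes {b : ι → ℂ} {X : ℝ} {q : ι × ℤ} :
    q ∈ lowModes b X ↔ q.2 ≠ 0 ∧ |(q.2 : ℝ)| ≤ ‖b q.1‖ * X := by
  rw [lowModes, Finset.mem_map_equiv]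
  simp only [Equiv.sigmaEquivProd_symm_apply, Finset.mem_sigma, Finset.mem_univ, true_and,
    Finset.mem_erase, Finset.mem_Icc]
  rw [← abs_le, Int.le_floor, Int.cast_abs]

theorem card_lowModes (b : ι → ℂ) {X : ℝ} (hX : 0 ≤ X) :
    ((lowModes b X).card : ℤ) = ∑ j, 2 * ⌊‖b j‖ * X⌋ := by
  rw [lowModes, Finset.card_map, Finset.card_sigma, Nat.cast_sum]
  refine Finset.sum_congr rfl fun j _ => ?_
  have hfloor : 0 ≤ ⌊‖b j‖ * X⌋ := Int.floor_nonneg.2 (by positivity)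
  rw [Finset.card_erase_of_mem (Finset.mem_Icc.2 (by lia)), Int.card_Icc]
  lia

theorem card_lowModes_le (b : ι → ℂ) {X : ℝ} (hX : 0 ≤ X) :
    ((lowModes b X).card : ℝ) ≤ 2 * ((∑ j, ‖b j‖) * X) := by
  rw [← Int.cast_natCast, card_lowModes b hX, ← Finset.mul_sum, Finset.sum_mul]
  push_cast
  gcongr
  exact Int.floor_le _

theorem le_card_lowModes (b : ι → ℂ) {X : ℝ} (hX : 0 ≤ X) :
    2 * ((∑ j, ‖b j‖) * X) - 2 * Fintype.card ι ≤ (lowModes b X).card := by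
  rw [← Int.cast_natCast (lowModes b X).card, card_lowModes b hX, ← Finset.mul_sum,
    Finset.sum_mul, ← mul_sub,
    ← nsmul_one, ← Finset.card_univ, ← Finset.sum_const, ← Finset.sum_sub_distrib]
  push_cast
  gcongr
  exact (Int.sub_one_lt_floor _).le

variable [DecidableEq ι]

theorem leadingTerm_iDiag_coord (b : ι → ℂ) (f : Lp (EuclideanSpace ℂ ι) 2 unitVolume) (j : ι)
    (t : unitInterval) :
    (iDiag b).compLeftContinuous ℂ unitInterval (volterra f) t j =
      Complex.I * b j * ∫ x in (0 : ℝ)..t, f x j := by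
  have hcomm := (EuclideanSpace.proj (𝕜 := ℂ) j).intervalIntegral_comp_comm
    (intervalIntegrable_of_mem_unitInterval (integrable_of_L2 f) unitInterval.zero_mem t.2)
  exact (iDiag_apply b _ j).trans (congrArg _ hcomm.symm)

theorem inner_fourierHilbertBasis_leadingTerm (b : ι → ℂ)
    {f : Lp (EuclideanSpace ℂ ι) 2 unitVolume} {j : ι}
    (hf : inner ℂ (fourierHilbertBasis (j, 0)) f = 0) {k : ℤ} (hk : k ≠ 0) :
    inner ℂ (fourierHilbertBasis (j, k)) (leadingTerm (iDiag b) f) =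
      b j / (2 * Real.pi * k) * inner ℂ (fourierHilbertBasis (j, k)) f := by
  rw [inner_fourierHilbertBasis] at hf
  have hf_int : IntervalIntegrable (fun x => f x j) volume 0 1 :=
    intervalIntegrable_of_mem_unitInterval ((memLp_coord f j).integrable one_le_two)
      unitInterval.zero_mem unitInterval.one_mem
  have hcoeff := fourierCoeffOn_toL2 _ j (g := fun t => Complex.I * b j * ∫ x in (0 : ℝ)..t, f x j)
    (leadingTerm_iDiag_coord b f j)
  rw [inner_fourierHilbertBasis, inner_fourierHilbertBasis, leadingTerm_eq_toL2, hcoeff,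
    fourierCoeffOn.const_mul, fourierCoeffOn_integral zero_lt_one hf_int hf hk]
  have := Real.pi_ne_zero
  have := Complex.I_ne_zero
  push_cast
  field_simp
  ring

theorem isDiagonalOutside_leadingTerm_iDiag (b : ι → ℂ) :
    IsDiagonalOutside fourierHilbertBasis (Finset.univ ×ˢ {0})
      (fun q : ι × ℤ => ‖b q.1‖ / (2 * Real.pi * |(q.2 : ℝ)|))
      (leadingTerm (iDiag b)).toLinearMap := by
  rintro f hf ⟨j, k⟩ hk
  have hk : k ≠ 0 := by simpa [eq_comm] using hk
  have hj : inner ℂ (fourierHilbertBasis (j, 0)) f = 0 := hf (j, 0) (by simp)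
  rw [ContinuousLinearMap.coe_coe, inner_fourierHilbertBasis_leadingTerm b hj hk, norm_mul,
    norm_div, norm_mul, norm_mul, Complex.norm_intCast, Complex.norm_real, Complex.norm_ofNat,
    Real.norm_of_nonneg Real.pi_pos.le]

variable {b : ι → ℂ} {X : ℝ}

theorem gelfandLE_leadingTerm_iDiag (hX : 0 < X) :
    GelfandLE (leadingTerm (iDiag b)).toLinearMap
      (Fintype.card ι + (lowModes b X).card + Fintype.card ι) (1 / (2 * Real.pi * X)) := by
  have := Real.pi_pos
  have hdiag := (isDiagonalOutside_leadingTerm_iDiag b).gelfandLE (S := lowModes b X)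
    (t := 1 / (2 * Real.pi * X)) (by positivity) fun q hq hqX => by
      have hk : q.2 ≠ 0 := fun h => hq (by simp [← h])
      have : (0 : ℝ) < |(q.2 : ℝ)| := abs_pos.2 (by exact_mod_cast hk)
      have hlt : ‖b q.1‖ * X < |(q.2 : ℝ)| := not_le.1 fun h => hqX (mem_lowModes.2 ⟨hk, h⟩)
      rw [div_le_div_iff₀ (by positivity) (by positivity)]
      nlinarith
  simpa using hdiag

theorem isCompactOperator_leadingTerm_iDiag (b : ι → ℂ) :
    IsCompactOperator (leadingTerm (iDiag b)) := by
  refine isCompactOperator_of_gelfandLE fun ε hε => ?_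
  have := Real.pi_pos
  refine ⟨_, (gelfandLE_leadingTerm_iDiag (X := 1 / (2 * Real.pi * ε)) (by positivity)).mono le_rfl
    (le_of_eq ?_)⟩
  field_simp

theorem singularValue_leadingTerm_iDiag_le (hX : 0 < X) {N : ℕ}
    (hN : 2 * ((∑ j, ‖b j‖) * X) + 2 * Fintype.card ι ≤ N) :
    singularValue (leadingTerm (iDiag b)) N ≤ 1 / (2 * Real.pi * X) := by
  have := Real.pi_pos
  have hcard := card_lowModes_le b hX.le
  refine singularValue_le (by positivity) ((gelfandLE_leadingTerm_iDiag hX).mono ?_ le_rfl)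
  rify
  linarith

theorem le_singularValue_leadingTerm_iDiag (hX : 0 < X) {N : ℕ}
    (hN : (N : ℝ) + 2 * Fintype.card ι < 2 * ((∑ j, ‖b j‖) * X)) :
    1 / (2 * Real.pi * X) ≤ singularValue (leadingTerm (iDiag b)) N := by
  have := Real.pi_pos
  refine (isDiagonalOutside_leadingTerm_iDiag b).le_singularValue (S := lowModes b X)
    (isCompactOperator_leadingTerm_iDiag b) (by positivity) ?_ (fun q hq => ?_) ?_
  · refine Finset.disjoint_left.2 fun q hq hq0 => (mem_lowModes.1 hq).1 ?_
    exact Finset.mem_singleton.1 (Finset.mem_product.1 hq0).2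
  · obtain ⟨hk, hle⟩ := mem_lowModes.1 hq
    have : (0 : ℝ) < |(q.2 : ℝ)| := abs_pos.2 (by exact_mod_cast hk)
    rw [div_le_div_iff₀ (by positivity) (by positivity)]
    nlinarith
  · rify
    linarith [le_card_lowModes b hX.le]

theorem tendsto_succ_mul_div_add (a c : ℝ) :
    Tendsto (fun N : ℕ => ((N : ℝ) + 1) * (a / (N + c))) atTop (𝓝 a) := by
  have h := (tendsto_add_mul_div_add_mul_atTop_nhds 1 c 1 (one_ne_zero (α := ℝ))).const_mul a
  rw [div_one, mul_one] at h
  exact h.congr fun N => by ring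

theorem tendsto_succ_mul_singularValue_leadingTerm_iDiag (hb : 0 < ∑ j, ‖b j‖) :
    Tendsto (fun N : ℕ => ((N : ℝ) + 1) * singularValue (leadingTerm (iDiag b)) N) atTop
      (𝓝 (∑ j, ‖b j‖ / Real.pi)) := by
  have := Real.pi_pos
  rw [← Finset.sum_div]
  set S := ∑ j, ‖b j‖ with hS
  set m : ℝ := 2 * Fintype.card ι
  have : 0 ≤ m := by positivity
  have hbound {r : ℝ} (hr : 0 < r) : 1 / (2 * Real.pi * (r / (2 * S))) = S / Real.pi / r := by
    field_simp
  have hX {r : ℝ} : 2 * (S * (r / (2 * S))) = r := by field_simp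
  refine tendsto_of_tendsto_of_tendsto_of_le_of_le' (tendsto_succ_mul_div_add (S / Real.pi) (m + 1))
    (tendsto_succ_mul_div_add (S / Real.pi) (-m)) (Eventually.of_forall fun N => ?_) ?_
  · have hr : 0 < (N : ℝ) + (m + 1) := by positivity
    gcongr
    rw [← hbound hr]
    exact le_singularValue_leadingTerm_iDiag (by positivity) (by rw [← hS, hX]; linarith)
  · filter_upwards [tendsto_natCast_atTop_atTop.eventually_gt_atTop m] with N hN
    have hr : 0 < (N : ℝ) + -m := by linarith
    gcongr
    rw [← hbound hr]
    exact singularValue_leadingTerm_iDiag_le (by positivity) (by rw [← hS, hX]; linarith)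

end LeadingTermSpectrum

section Ideals

variable {H : Type*} [NormedAddCommGroup H] [InnerProductSpace ℂ H] [CompleteSpace H]
variable {T : H →L[ℂ] H} {a : ℝ}

theorem isWeakSchatten_one_of_tendsto (hT : IsCompactOperator T)
    (ha : Tendsto (fun N : ℕ => ((N : ℝ) + 1) * singularValue T N) atTop (𝓝 a)) :
    IsWeakSchatten 1 T := by
  have hinv := (ha.isBigO_one ℝ).mul
    (Asymptotics.isBigO_refl (fun N : ℕ => ((N : ℝ) + 1)⁻¹) atTop)
  refine ⟨hT, (hinv.congr (fun N => ?_) fun N => ?_)⟩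
  · have hN : (N : ℝ) + 1 ≠ 0 := by positivity
    field_simp
  · rw [one_mul, div_one, Real.rpow_neg_one]

theorem not_isSchatten_one_of_tendsto (ha₀ : a ≠ 0)
    (ha : Tendsto (fun N : ℕ => ((N : ℝ) + 1) * singularValue T N) atTop (𝓝 a)) :
    ¬ IsSchatten 1 T := by
  rintro ⟨-, hsum⟩
  simp only [Real.rpow_one] at hsum
  have hharmonic : (fun N : ℕ => ((N : ℝ) + 1)⁻¹) =O[atTop] fun N => singularValue T N := by
    have hinv := ((ha.inv₀ ha₀).isBigO_one ℝ).mul (Asymptotics.isBigO_refl (singularValue T) atTop)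
    refine hinv.congr' ?_ (Eventually.of_forall fun N => one_mul _)
    filter_upwards [ha.eventually_ne ha₀] with N hN
    rw [mul_inv, inv_mul_cancel_right₀ (right_ne_zero_of_mul hN)]
  have hsum_inv := summable_of_isBigO_nat hsum hharmonic
  exact Real.not_summable_natCast_inv ((summable_nat_add_iff 1).1 (by
    simpa only [Nat.cast_add, Nat.cast_one] using hsum_inv))

end Ideals

section Resolvent

variable {n : ℕ} {b : Fin n → ℂ} {C D : Matrix (Fin n) (Fin n) ℂ}
  {Q : ℝ → Matrix (Fin n) (Fin n) ℂ} {z : ℂ} {R : L2 n →L[ℂ] L2 n}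

theorem IsResolventAt.isCompactOperator (hb : ∀ j, b j ≠ 0)
    (hQ : ∀ j k, IntegrableOn (fun x => Q x j k) (Set.Icc (0 : ℝ) 1))
    (hR : IsResolventAt (op b C D Q) z R) : IsCompactOperator R := by
  have hsub := isCompactOperator_sub_leadingTerm (integrable_shiftedPotential hQ z)
    (hR.exists_isSolution hb hQ)
  simpa using (isCompactOperator_leadingTerm_iDiag b).add hsub

theorem IsResolventAt.tendsto_succ_mul_singularValue [NeZero n] (hb : ∀ j, b j ≠ 0)
    (hQ : ∀ j k, IntegrableOn (fun x => Q x j k) (Set.Icc (0 : ℝ) 1))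
    (hR : IsResolventAt (op b C D Q) z R) :
    Tendsto (fun N : ℕ => ((N : ℝ) + 1) * singularValue R N) atTop
      (𝓝 (∑ j, ‖b j‖ / Real.pi)) := by
  have hP := integrable_shiftedPotential hQ z
  have hsol := hR.exists_isSolution hb hQ
  have hsum : 0 < ∑ j, ‖b j‖ :=
    Finset.sum_pos (fun j _ => norm_pos_iff.2 (hb j)) Finset.univ_nonempty
  have hlim := tendsto_succ_mul_singularValue_add (isCompactOperator_leadingTerm_iDiag b)
    (isCompactOperator_sub_leadingTerm hP hsol)
    (tendsto_succ_mul_singularValue_leadingTerm_iDiag hsum)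
    (tendsto_succ_mul_singularValue_sub_leadingTerm hP hsol)
  rwa [add_sub_cancel] at hlim

end Resolvent

theorem exists_eq_add_div_pi_mul_succ {β : ℝ} {s : ℕ → ℝ}
    (hs : Tendsto (fun k : ℕ => ((k : ℝ) + 1) * s k) atTop (𝓝 (β / Real.pi))) :
    ∃ ε : ℕ → ℝ, Tendsto ε atTop (𝓝 0) ∧ ∀ k : ℕ, s k = (β + ε k) / (Real.pi * ((k : ℝ) + 1)) := by
  have hpi := Real.pi_pos
  refine ⟨fun k => Real.pi * (((k : ℝ) + 1) * s k) - β, ?_, fun k => ?_⟩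
  · simpa [mul_div_cancel₀, hpi.ne'] using (hs.const_mul Real.pi).sub_const β
  · have hk : (k : ℝ) + 1 ≠ 0 := by positivity
    field_simp
    ring

end DiracBVP

theorem mainTheorem6 (n : ℕ) (hn : 1 ≤ n) (b : Fin n → ℂ) (hb : ∀ j, b j ≠ 0)
    (C D : Matrix (Fin n) (Fin n) ℂ) (hCD : (Matrix.fromCols C D).rank = n)
    (Q : ℝ → Matrix (Fin n) (Fin n) ℂ)
    (hQ : ∀ j k, IntegrableOn (fun x => Q x j k) (Set.Icc (0 : ℝ) 1))
    (z : ℂ) (hz : z ∈ DiracBVP.resolventSet (DiracBVP.op b C D Q)) :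
    -- membership in the weak ideal of exponent `1`, but not in the trace class
    (DiracBVP.IsWeakSchatten 1 (DiracBVP.resolvent (DiracBVP.op b C D Q) z) ∧
      ¬ DiracBVP.IsSchatten 1 (DiracBVP.resolvent (DiracBVP.op b C D Q) z)) ∧
    -- `ν j` lists, in increasing order, the positions of the `j`-th subsequence; the `n`
    -- subsequences are disjoint and exhaust the sequence of singular values (indexed from `0`)
    ∃ ν : Fin n → ℕ → ℕ, (∀ j, StrictMono (ν j)) ∧
      Function.Bijective (fun p : Fin n × ℕ => ν p.1 p.2) ∧
      ∀ j, Antitone (fun k : ℕ =>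
          DiracBVP.singularValue (DiracBVP.resolvent (DiracBVP.op b C D Q) z) (ν j k)) ∧
        ∃ ε : ℕ → ℝ, Tendsto ε atTop (𝓝 0) ∧
          ∀ k : ℕ, DiracBVP.singularValue (DiracBVP.resolvent (DiracBVP.op b C D Q) z) (ν j k)
            = (‖b j‖ + ε k) / (Real.pi * ((k : ℝ) + 1)) := by
  have : NeZero n := ⟨by lia⟩
  have hR := DiracBVP.isResolventAt_resolvent hz
  set R := DiracBVP.resolvent (DiracBVP.op b C D Q) z
  have hpos (j : Fin n) : 0 < ‖b j‖ / Real.pi := div_pos (norm_pos_iff.2 (hb j)) Real.pi_pos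
  have hlim := hR.tendsto_succ_mul_singularValue hb hQ
  have hlim_ne : ∑ j, ‖b j‖ / Real.pi ≠ 0 :=
    (Finset.sum_pos (fun j _ => hpos j) Finset.univ_nonempty).ne'
  obtain ⟨ν, hmono, hbij, hν⟩ := DiracBVP.exists_subsequences_tendsto hpos hlim
  exact ⟨⟨DiracBVP.isWeakSchatten_one_of_tendsto (hR.isCompactOperator hb hQ) hlim,
      DiracBVP.not_isSchatten_one_of_tendsto hlim_ne hlim⟩,
    ν, hmono, hbij, fun j =>
      ⟨(DiracBVP.singularValue_antitone R).comp_monotone (hmono j).monotone,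
        DiracBVP.exists_eq_add_div_pi_mul_succ (hν j)⟩⟩
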